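/- Fix $T>0$, $\beta^\star\in\mathbb R$, $\theta^\star>0$. Let $X_t=\beta^\star t+(\theta^\star)^{1/2}W_t+J_t$, $t\in[0,T]$, where $W$ is a standard Brownian motion and $J$ is a process independent of $W$ whose paths are almost surely pure jump paths of finite activity: $J_0=0$, there are finitely many jump times in $(0,T]$, all jumps are finite, and $J_t$ is the sum of the jumps up to and including time $t$. Let $[J]=\sum_{0<s\le T}(J_s-J_{s-})^2$ be its quadratic variation and $\theta^\dagger=\theta^\star+T^{-1}[J]$. For $n\ge 1$ put $\Delta_n=T/n$, $t_i=iT/n$ and $D_i=X_{t_i}-X_{t_{i-1}}$, $i=1,\dots,n$. Let $\mathsf P^\star$ be the distribution of $(D_1,\dots,D_n)$ and $\mathsf P^\star_J$ its conditional distribution given the path $J$. Let $\pi$ be a probability density on $(0,\infty)$ (the prior), fix $m>0$ and $\omega\in(0,\tfrac12)$, let $\eta_n=m\,n^{-\omega}$, and define $$\hat\theta_n=\frac1T\sum_{i=1}^n D_i^2,\qquad \hat J_n=\sum_{i=1}^n D_i^2\,1(|D_i|>\eta_n),\qquad \kappa_n=\Bigl(1-\frac{\hat J_n}{T\hat\theta_n}\Bigr)^2,$$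 $$L_n(\theta)=\theta^{-n/2}\exp\Bigl\{-\frac{1}{2\Delta_n\theta}\sum_{i=1}^n D_i^2\Bigr\},\qquad \Pi_n(A)=\frac{\int_A L_n(\theta)^{1/\kappa_n}\pi(\theta)\,d\theta}{\int_0^\infty L_n(\theta)^{1/\kappa_n}\pi(\theta)\,d\theta},\quad A\subseteq(0,\infty).$$ Let $\widetilde\Pi_n$ be the distribution of $\theta-T^{-1}\hat J_n$ when $\theta\sim\Pi_n$, and let $d$ be the total variation distance. Theorem. For almost every $J$ such that $\pi$ is continuous and positive in a neighborhood of $\theta^\dagger$, $$d\bigl(\widetilde\Pi_n,\ \mathsf N(\hat\theta_n-T^{-1}\hat J_n,\ 2\theta^{\star2}n^{-1})\bigr)\to 0\quad\text{in }\mathsf P^\star_J\text{-probability as }n\to\infty.$$ If $\pi$ is continuous and positive in a neighborhood of $\theta^\dagger$ for almost every $J$, the same convergence also holds in $\mathsf P^\star$-probability. -/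

import Mathlib

open MeasureTheory ProbabilityTheory Filter Set
open scoped NNReal ENNReal Topology

noncomputable section

namespace JumpDiffusion

/-- The time horizon `[0, T]`. -/
abbrev Horizon (T : ℝ≥0) : Type := Set.Iic T

/-- The time `0` of the horizon `[0, T]`. -/
def startTime (T : ℝ≥0) : Horizon T := ⟨0, Set.mem_Iic.mpr zero_le⟩

lemma grid_le (T : ℝ≥0) (n : ℕ) (i : Fin (n + 1)) : ((i : ℕ) : ℝ≥0) * T / (n : ℝ≥0) ≤ T := by
  rcases Nat.eq_zero_or_pos n with h | h
  · subst h; simp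
  · have hn : (0 : ℝ≥0) < n := by exact_mod_cast h
    rw [div_le_iff₀ hn, mul_comm]
    gcongr
    exact_mod_cast Nat.lt_succ_iff.mp i.2

/-- The equally spaced observation times `t_i = i T / n`, `i = 0, …, n`. -/
def grid (T : ℝ≥0) (n : ℕ) (i : Fin (n + 1)) : Horizon T :=
  ⟨((i : ℕ) : ℝ≥0) * T / (n : ℝ≥0), grid_le T n i⟩

/-- Standard Brownian motion `(W_t : t ∈ [0, T])` on a fixed horizon: it starts at `0`, has
independent increments, its increments are `N(0, t - s)`, and its paths are a.s. continuous. -/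
structure IsBrownianOn {Ω : Type*} [MeasurableSpace Ω] (T : ℝ≥0) (W : Horizon T → Ω → ℝ)
    (P : Measure Ω) : Prop where
  zero : ∀ᵐ ω ∂P, W (startTime T) ω = 0
  indep : HasIndepIncrements W P
  law : ∀ s t : Horizon T, s ≤ t →
    HasLaw (fun ω => W t ω - W s ω) (gaussianReal 0 ((t : ℝ≥0) - (s : ℝ≥0))) P
  cont : ∀ᵐ ω ∂P, Continuous fun t => W t ω

/-- A pure jump path of finite activity on `[0, T]`, started at `0`: there are finitely many jump
times in `(0, T]`, with finite jump sizes, and the value at time `t` is the sum of the jumps up to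
and including time `t`. -/
def IsFinitePureJump {T : ℝ≥0} (j : Horizon T → ℝ) : Prop :=
  ∃ (S : Finset (Horizon T)) (a : Horizon T → ℝ),
    (∀ s ∈ S, startTime T < s) ∧ ∀ t, j t = ∑ s ∈ S with s ≤ t, a s

/-- The jump `j(s) - j(s-)` of a path at time `s` (it is `0` at time `0`). -/
def jump {T : ℝ≥0} (j : Horizon T → ℝ) (s : Horizon T) : ℝ := j s - Function.leftLim j s

/-- The quadratic variation `[J]` of a finite activity pure jump path: the sum of the squares of
its (finitely many nonzero) jumps in `(0, T]`. -/
def quadVar {T : ℝ≥0} (j : Horizon T → ℝ) : ℝ := ∑ᶠ s : Horizon T, jump j s ^ 2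

/-- The jump diffusion `X_t = β t + θ^{1/2} W_t + J_t`. -/
def diffusion {Ω : Type*} {T : ℝ≥0} (β θ : ℝ) (W J : Horizon T → Ω → ℝ) (t : Horizon T)
    (ω : Ω) : ℝ :=
  β * ((t : ℝ≥0) : ℝ) + Real.sqrt θ * W t ω + J t ω

/-- The observed differences `D_i = X_{t_i} - X_{t_{i-1}}`, `i = 1, …, n`. -/
def increments {Ω : Type*} {T : ℝ≥0} (β θ : ℝ) (W J : Horizon T → Ω → ℝ) (n : ℕ) (ω : Ω) :
    Fin n → ℝ :=
  fun i => diffusion β θ W J (grid T n i.succ) ω - diffusion β θ W J (grid T n i.castSucc) ω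

/-- The path `t ↦ Y_t(ω)` of a process. -/
def path {Ω : Type*} {T : ℝ≥0} (Y : Horizon T → Ω → ℝ) (ω : Ω) : Horizon T → ℝ := fun t => Y t ω

/-- The likelihood of the misspecified model, in which the differences are iid `N(0, θ Δ_n)` with
`Δ_n = T / n`, up to a factor not depending on `θ`. -/
def likelihood (T : ℝ) {n : ℕ} (x : Fin n → ℝ) (θ : ℝ) : ℝ :=
  θ ^ (-(n : ℝ) / 2) * Real.exp (-(1 / (2 * (T / n) * θ)) * ∑ i, x i ^ 2)

/-- The maximum likelihood estimator `θ̂_n = T⁻¹ ∑ D_i²` in the misspecified model. -/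
def mle (T : ℝ) {n : ℕ} (x : Fin n → ℝ) : ℝ := T⁻¹ * ∑ i, x i ^ 2

/-- The thresholded estimator `∑ D_i² 1(|D_i| > η)` of the quadratic variation of the jumps. -/
def jumpQV (η : ℝ) {n : ℕ} (x : Fin n → ℝ) : ℝ := ∑ i, if η < |x i| then x i ^ 2 else 0

/-- The temperature `κ_n = (1 - Ĵ_n / (T θ̂_n))²`. -/
def temperature (T η : ℝ) {n : ℕ} (x : Fin n → ℝ) : ℝ := (1 - jumpQV η x / (T * mle T x)) ^ 2

/-- `π` is a probability density on `(0, ∞)` (its values elsewhere play no role). -/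
structure IsPriorDensity (π : ℝ → ℝ) : Prop where
  measurable : Measurable π
  nonneg : ∀ θ, 0 < θ → 0 ≤ π θ
  mass : ∫⁻ θ in Ioi (0 : ℝ), ENNReal.ofReal (π θ) = 1

/-- The unnormalized pseudo-posterior: density `L_n(θ)^{1/κ} π(θ)` on `(0, ∞)`. -/
def unnormalizedPosterior (T : ℝ) (π : ℝ → ℝ) (κ : ℝ) {n : ℕ} (x : Fin n → ℝ) : Measure ℝ :=
  (volume.restrict (Ioi (0 : ℝ))).withDensity
    fun θ => ENNReal.ofReal (likelihood T x θ ^ (1 / κ) * π θ)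

/-- The pseudo-posterior `Π_n` with temperature `κ`. -/
def posterior (T : ℝ) (π : ℝ → ℝ) (κ : ℝ) {n : ℕ} (x : Fin n → ℝ) : Measure ℝ :=
  (unnormalizedPosterior T π κ x univ)⁻¹ • unnormalizedPosterior T π κ x

/-- The modified posterior `Π̃_n`: the distribution of `θ - T⁻¹ Ĵ_n` when `θ ∼ Π_n`, with
temperature `κ_n`. -/
def modifiedPosterior (T : ℝ) (π : ℝ → ℝ) (η : ℝ) {n : ℕ} (x : Fin n → ℝ) : Measure ℝ :=
  (posterior T π (temperature T η x) x).map fun θ => θ - T⁻¹ * jumpQV η x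

/-- Total variation distance between two probability measures on the real line. -/
def tvDist (μ ν : Measure ℝ) : ℝ :=
  ⨆ A : {A : Set ℝ // MeasurableSet A}, |μ.real A - ν.real A|

/-- The total variation distance between the modified posterior and the normal distribution
`N(θ̂_n - T⁻¹ Ĵ_n, 2 θ² / n)`, as a function of the observed differences. -/
def normalDiscrepancy (T : ℝ) (π : ℝ → ℝ) (θ η : ℝ) {n : ℕ} (x : Fin n → ℝ) : ℝ :=
  tvDist (modifiedPosterior T π η x)
    (gaussianReal (mle T x - T⁻¹ * jumpQV η x) (2 * θ ^ 2 / n).toNNReal)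

/-- The statistics `d n` of `n` observations tend to `0` in probability when, for each `n`, the
observations have distribution `Q n`. -/
def TendsToZeroInProb (Q : (n : ℕ) → Measure (Fin n → ℝ)) (d : (n : ℕ) → (Fin n → ℝ) → ℝ) : Prop :=
  ∀ ε : ℝ, 0 < ε → Tendsto (fun n => Q n {x | ε < d n x}) atTop (𝓝 0)

/-- `π` is continuous and positive in a neighbourhood of `a`. -/
def ContinuousPositiveNear (π : ℝ → ℝ) (a : ℝ) : Prop := ∀ᶠ x in 𝓝 a, ContinuousAt π x ∧ 0 < π x

end JumpDiffusion

end

open JumpDiffusion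

/-!
# Bernstein–von Mises theorem for the modified posterior of a jump diffusion

The discrepancy depends on the data only through `a = mle` and the truncated estimator
`s = mle - T⁻¹ jumpQV`. With `κ = (s / a) ^ 2` the tempered likelihood is, up to a constant, the
exponential of `-n / (2 κ) * profileLoss (θ / a)`, where `profileLoss y = log y + 1 / y - 1` behaves
like `(y - 1) ^ 2 / 2` near its minimum `y = 1`. By Laplace's method
(`tendsto_integral_localPosterior_sub`) the posterior is therefore close to the normal distribution
with mean `a` and variance `2 κ a ^ 2 / n = 2 s ^ 2 / n`, as soon as `a` stays near a point where the
prior is continuous and positive. The temperature corrects the variance exactly so that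
it becomes the one of the model without jumps when `s` is close to `θ`. This gives a statement
about fixed samples, `exists_forall_normalDiscrepancy_le`, without any probability.

It remains that `a → θ + T⁻¹ [J]` and `s → θ` in probability, given the path of `J`
(`IsBrownianOn.tendsto_measure_estimators`). On a fine grid, every interval contains at most one
jump. By a Gaussian tail bound and `r < 1 / 2`, all increments of the continuous part are below the
threshold `m n ^ (-r)` with probability tending to one, so that thresholding finds precisely the
intervals with a jump; the squares of the Brownian increments add up to `T` in the limit by
Chebyshev's inequality. As `W` and `J` are independent, the conditional distribution given `J = j` is
the distribution with the path `j` inserted (`condDistrib_comp_ae_eq_of_indepFun`).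

The unconditional statement follows by integrating over `J`. As the neighbourhoods in which the
discrepancy is small depend on the path of `J`, and the discrepancy is not known to be a measurable
function of the sample, this uses measurable supersets (`exceptionalSet`) that do not depend on `J`.
-/

namespace JumpDiffusion

/-! ### The profile of the log-likelihood at its maximum -/

/-- The loss of log-likelihood, in units of `n / 2`, when the variance parameter is `y` times
the maximum likelihood estimator. -/
noncomputable def profileLoss (y : ℝ) : ℝ := Real.log y + y⁻¹ - 1

@[fun_prop]
lemma measurable_profileLoss : Measurable profileLoss := by
  unfold profileLoss; fun_prop

lemma sq_inv_sqrt_sub_one_le_profileLoss {y : ℝ} (hy : 0 < y) :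
    ((√y)⁻¹ - 1) ^ 2 ≤ profileLoss y := by
  have hs : 0 < √y := Real.sqrt_pos.mpr hy
  have h1 := Real.log_le_sub_one_of_pos (inv_pos.mpr hs)
  have h2 : Real.log ((√y)⁻¹) = -(Real.log y / 2) := by
    rw [Real.log_inv, Real.log_sqrt hy.le]
  have h3 : ((√y)⁻¹) ^ 2 = y⁻¹ := by rw [inv_pow, Real.sq_sqrt hy.le]
  unfold profileLoss
  nlinarith

lemma profileLoss_ge_near {y : ℝ} (hy : |y - 1| ≤ 1 / 2) : (y - 1) ^ 2 / 16 ≤ profileLoss y := by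
  obtain ⟨h1, h2⟩ := abs_le.mp hy
  have hy0 : 0 < y := by linarith
  refine le_trans ?_ (sq_inv_sqrt_sub_one_le_profileLoss hy0)
  set s := √y with hs
  have hs0 : 0 < s := Real.sqrt_pos.mpr hy0
  have hs2 : y = s ^ 2 := (Real.sq_sqrt hy0.le).symm
  have hs3 : s ≤ 5 / 4 := by
    rw [hs2] at h2; nlinarith
  have : (s⁻¹ - 1) ^ 2 - (y - 1) ^ 2 / 16 =
      (1 - s) ^ 2 * (16 - (s * (1 + s)) ^ 2) / (16 * s ^ 2) := by
    rw [hs2]; field_simp; ring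
  have h5 : s * (1 + s) ≤ 4 := by nlinarith
  have h6 : 0 ≤ 16 - (s * (1 + s)) ^ 2 := by nlinarith [mul_pos hs0 (by linarith : 0 < 1 + s)]
  have : 0 ≤ (s⁻¹ - 1) ^ 2 - (y - 1) ^ 2 / 16 := by rw [this]; positivity
  linarith

lemma profileLoss_ge_far {y δ : ℝ} (hy0 : 0 < y) (hδ0 : 0 < δ) (hδ : δ ≤ 1 / 2)
    (hy : δ ≤ |y - 1|) : δ ^ 2 / 16 ≤ profileLoss y := by
  refine le_trans ?_ (sq_inv_sqrt_sub_one_le_profileLoss hy0)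
  set s := √y with hs
  have hs0 : 0 < s := Real.sqrt_pos.mpr hy0
  have hs2 : y = s ^ 2 := (Real.sq_sqrt hy0.le).symm
  have key : δ / 4 ≤ |s⁻¹ - 1| := by
    rcases le_abs.mp hy with h | h
    · have h1 : 1 ≤ s * (1 - δ / 4) := by
        have h3 : 0 < s * (1 - δ / 4) := mul_pos hs0 (by linarith)
        by_contra! hlt
        have : (s * (1 - δ / 4)) ^ 2 < 1 := by nlinarith
        have : s ^ 2 * (1 - δ / 4) ^ 2 < 1 := by linarith [mul_pow s (1 - δ / 4) 2]
        have h4 : 0 ≤ (1 - δ / 4) ^ 2 * (s ^ 2 - (1 + δ)) :=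
          mul_nonneg (sq_nonneg _) (by linarith)
        have h5 : 1 ≤ (1 + δ) * (1 - δ / 4) ^ 2 := by
          nlinarith [mul_nonneg hδ0.le (by linarith : 0 ≤ 1 / 2 - δ), pow_pos hδ0 3]
        nlinarith
      have h2 : s⁻¹ ≤ 1 - δ / 4 := by
        rw [inv_le_iff_one_le_mul₀ hs0]; linarith
      rw [abs_sub_comm]
      exact le_trans (by linarith) (le_abs_self _)
    · have hs1 : s ≤ 1 := by nlinarith
      have h2 : 1 ≤ s⁻¹ := (one_le_inv₀ hs0).mpr hs1
      have h3 : 1 - s ≤ s⁻¹ - 1 := by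
        have : s * s⁻¹ = 1 := mul_inv_cancel₀ hs0.ne'
        nlinarith [sq_nonneg (s⁻¹ - 1)]
      refine le_trans ?_ (le_abs_self _)
      nlinarith
  have := pow_le_pow_left₀ (by positivity) key 2
  rw [sq_abs] at this
  linarith [div_pow δ 4 2]

/-- Second order expansion of `profileLoss` at its minimum. -/
lemma abs_profileLoss_sub_le {t : ℝ} (ht : |t| ≤ 1 / 2) :
    |profileLoss (1 + t) - t ^ 2 / 2| ≤ 4 * |t| ^ 3 := by
  have h1 := Real.abs_log_sub_add_sum_range_le (x := -t) (by rw [abs_neg]; linarith) 2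
  simp only [Finset.sum_range_succ, Finset.sum_range_zero, abs_neg, sub_neg_eq_add] at h1
  norm_num at h1
  have ht1 := (abs_le.mp ht).1
  have h0 : 0 < 1 + t := by linarith
  have h2 : profileLoss (1 + t) - t ^ 2 / 2
      = (-t + t ^ 2 / 2 + Real.log (1 + t)) - t ^ 3 / (1 + t) := by
    unfold profileLoss; field_simp; ring
  have h3 : |t ^ 3 / (1 + t)| ≤ 2 * |t| ^ 3 := by
    rw [abs_div, abs_pow, abs_of_pos h0, div_le_iff₀ h0]
    nlinarith [pow_nonneg (abs_nonneg t) 3]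
  have h4 : |t| ^ 3 / (1 - |t|) ≤ 2 * |t| ^ 3 := by
    rw [div_le_iff₀ (by linarith)]
    nlinarith [pow_nonneg (abs_nonneg t) 3]
  rw [h2]
  exact (abs_sub _ _).trans (by linarith)

lemma tendsto_mul_profileLoss {ι : Type*} {l : Filter ι} {R : ι → ℝ} (hR : Tendsto R l atTop)
    (h : ℝ) : Tendsto (fun i => R i ^ 2 * profileLoss (1 + h / R i)) l (𝓝 (h ^ 2 / 2)) := by
  rw [tendsto_iff_norm_sub_tendsto_zero]
  have h0 : Tendsto (fun i => h / R i) l (𝓝 0) := hR.const_div_atTop h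
  have h1 : ∀ᶠ i in l, |h / R i| ≤ 1 / 2 := by
    have := (h0.abs).eventually_le_const (u := 1 / 2) (by norm_num)
    simpa using this
  refine squeeze_zero' (Eventually.of_forall fun _ => norm_nonneg _)
    (g := fun i => 4 * |h| ^ 3 / R i) ?_ (hR.const_div_atTop _)
  filter_upwards [h1, hR.eventually_gt_atTop 0] with i hi hRi
  have e := abs_profileLoss_sub_le hi
  have : R i ^ 2 * profileLoss (1 + h / R i) - h ^ 2 / 2
      = R i ^ 2 * (profileLoss (1 + h / R i) - (h / R i) ^ 2 / 2) := by field_simp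
  rw [this, norm_mul, Real.norm_eq_abs, Real.norm_eq_abs, abs_of_pos (by positivity : 0 < R i ^ 2)]
  refine (mul_le_mul_of_nonneg_left e (by positivity)).trans (le_of_eq ?_)
  rw [abs_div, abs_of_pos hRi]; field_simp

/-! ### Laplace's method in the local parameter -/

/-- The posterior density in the local parameter `h`, where the parameter is `a (1 + h / R)`,
up to normalization by its value at the maximum of the likelihood. -/
noncomputable def localPosterior (p : ℝ → ℝ) (R a h : ℝ) : ℝ :=
  Real.exp (-(R ^ 2 * profileLoss (1 + h / R))) * p (a * (1 + h / R))

/-- The density of the centred normal distribution with variance `v`, for real `v`. -/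
noncomputable def centredGaussian (v h : ℝ) : ℝ :=
  (√(2 * Real.pi * v))⁻¹ * Real.exp (-h ^ 2 / (2 * v))

lemma integrable_affine_comp {p : ℝ → ℝ} (hp : Integrable p) {R a : ℝ} (hR : 0 < R) (ha : 0 < a) :
    Integrable fun h => p (a * (1 + h / R)) := by
  have := (hp.comp_add_left a).comp_mul_left' (div_pos ha hR).ne'
  refine this.congr (ae_of_all _ fun h => ?_)
  simp only
  congr 1; ring

lemma integral_affine_comp (p : ℝ → ℝ) {R a : ℝ} (hR : 0 < R) (ha : 0 < a) :
    ∫ h, p (a * (1 + h / R)) = R / a * ∫ x, p x := by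
  have h1 := Measure.integral_comp_mul_left (fun x => p (a + x)) (a / R)
  rw [integral_add_left_eq_self p a, inv_div, abs_of_pos (div_pos hR ha), smul_eq_mul] at h1
  rw [← h1]
  congr 1; ext h; congr 1; ring

/-- Away from the maximum likelihood estimator the posterior density is exponentially small. -/
lemma localPosterior_le_far {p : ℝ → ℝ} (hp0 : ∀ x, 0 ≤ p x) (hpneg : ∀ x, x ≤ 0 → p x = 0)
    {R a δ h : ℝ} (ha : 0 < a) (hδ0 : 0 < δ) (hδ : δ ≤ 1 / 2) (hh : δ ≤ |h / R|) :
    localPosterior p R a h ≤ Real.exp (-(R ^ 2 * (δ ^ 2 / 16))) * p (a * (1 + h / R)) := by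
  unfold localPosterior
  rcases le_or_gt (1 + h / R) 0 with h0 | h0
  · rw [hpneg _ (mul_nonpos_of_nonneg_of_nonpos ha.le h0)]; simp
  · gcongr
    · exact hp0 _
    · exact profileLoss_ge_far h0 hδ0 hδ (by simpa using hh)

/-- **Laplace's method**: in the local parameter, the posterior density divided by its asymptotic
normalizing constant converges in `L¹` to the normal density. The prior `p` is extended by `0` to
the half-line of nonpositive numbers. -/
theorem tendsto_integral_localPosterior_sub {ι : Type*} {l : Filter ι} [l.IsCountablyGenerated]
    {R a v : ι → ℝ} {a₀ : ℝ} (ha₀ : 0 < a₀) (hR : Tendsto R l atTop)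
    (ha : Tendsto a l (𝓝 a₀)) (hv : Tendsto v l (𝓝 1)) {p : ℝ → ℝ} (hpm : Measurable p)
    (hp0 : ∀ x, 0 ≤ p x) (hpneg : ∀ x, x ≤ 0 → p x = 0) (hpi : Integrable p)
    (hpc : ContinuousAt p a₀) (hpa : 0 < p a₀) :
    Tendsto (fun i => ∫ h, |localPosterior p (R i) (a i) h / (p a₀ * √(2 * Real.pi))
      - centredGaussian (v i) h|) l (𝓝 0) := by
  set C := p a₀ * √(2 * Real.pi) with hC
  have hsq : 0 < √(2 * Real.pi) := Real.sqrt_pos.mpr (by positivity)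
  have hC0 : 0 < C := mul_pos hpa hsq
  -- the prior is bounded on a neighbourhood `(a₀ - r, a₀ + r)`
  obtain ⟨r, hr0, hr⟩ := Metric.eventually_nhds_iff.mp
    (hpc.eventually_lt_const (lt_two_mul_self hpa))
  obtain ⟨δ, hδ0, hδ, hδr⟩ : ∃ δ : ℝ, 0 < δ ∧ δ ≤ 1 / 2 ∧ 2 * a₀ * δ ≤ r / 2 := by
    refine ⟨min (1 / 2) (r / (4 * a₀)), by positivity, min_le_left _ _, ?_⟩
    calc 2 * a₀ * min (1 / 2) (r / (4 * a₀)) ≤ 2 * a₀ * (r / (4 * a₀)) := by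
          gcongr; exact min_le_right _ _
      _ = r / 2 := by field_simp; ring
  have ev_a : ∀ᶠ i in l, 0 < a i ∧ a i < 2 * a₀ ∧ |a i - a₀| < r / 2 := by
    filter_upwards [ha.eventually_const_lt ha₀, ha.eventually_lt_const (lt_two_mul_self ha₀),
      Metric.tendsto_nhds.mp ha (r / 2) (by positivity)] with i h1 h2 h3
    exact ⟨h1, h2, h3⟩
  have ev_v : ∀ᶠ i in l, 1 / 2 < v i ∧ v i < 2 :=
    (hv.eventually_const_lt (by norm_num)).and (hv.eventually_lt_const (by norm_num))
  have hmeasV : ∀ i, Measurable (localPosterior p (R i) (a i)) := by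
    intro i; unfold localPosterior; fun_prop
  have hmeasG : ∀ x, Measurable (centredGaussian x) := by
    intro x; unfold centredGaussian; fun_prop
  let near : ι → Set ℝ := fun i => {h | |h / R i| ≤ δ}
  have hnear : ∀ i, MeasurableSet (near i) := fun i =>
    measurableSet_le (by fun_prop) measurable_const
  let F : ι → ℝ → ℝ := fun i h =>
    |(near i).indicator (fun h => localPosterior p (R i) (a i) h / C) h - centredGaussian (v i) h|
  let bound : ℝ → ℝ := fun h =>
    2 * p a₀ / C * Real.exp (-(1 / 16) * h ^ 2) + (√Real.pi)⁻¹ * Real.exp (-(1 / 4) * h ^ 2)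
  have hbound : Integrable bound :=
    ((integrable_exp_neg_mul_sq (by norm_num)).const_mul _).add
      ((integrable_exp_neg_mul_sq (by norm_num)).const_mul _)
  have hFmeas : ∀ i, AEStronglyMeasurable (F i) volume := fun i =>
    ((((hmeasV i).div_const C).indicator (hnear i)).sub (hmeasG _)).abs.aestronglyMeasurable
  have hFb : ∀ᶠ i in l, ∀ h, ‖F i h‖ ≤ bound h := by
    filter_upwards [ev_a, ev_v, hR.eventually_gt_atTop 0] with i ⟨ha1, ha2, ha3⟩ ⟨hv1, hv2⟩ hRi h
    rw [Real.norm_eq_abs, abs_abs]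
    refine (abs_sub _ _).trans (add_le_add ?_ ?_)
    · by_cases hh : h ∈ near i
      · rw [indicator_of_mem hh]
        have hh' : |h / R i| ≤ δ := hh
        have h1 := profileLoss_ge_near (y := 1 + h / R i) (by simpa using hh'.trans hδ)
        have h2 : p (a i * (1 + h / R i)) ≤ 2 * p a₀ := by
          refine (hr ?_).le
          rw [Real.dist_eq]
          calc |a i * (1 + h / R i) - a₀| = |(a i - a₀) + a i * (h / R i)| := by congr 1; ring
            _ ≤ |a i - a₀| + |a i * (h / R i)| := abs_add_le _ _
            _ < r / 2 + r / 2 := by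
                refine add_lt_add_of_lt_of_le ha3 ?_
                rw [abs_mul, abs_of_pos ha1]
                exact (mul_le_mul ha2.le hh' (abs_nonneg _) (by positivity)).trans hδr
            _ = r := by ring
        have h3 : Real.exp (-(R i ^ 2 * profileLoss (1 + h / R i)))
            ≤ Real.exp (-(1 / 16) * h ^ 2) := by
          refine Real.exp_le_exp.mpr ?_
          have : R i ^ 2 * ((1 + h / R i - 1) ^ 2 / 16) = 1 / 16 * h ^ 2 := by field_simp; ring
          nlinarith [mul_le_mul_of_nonneg_left h1 (sq_nonneg (R i))]
        have h4 : 0 ≤ localPosterior p (R i) (a i) h := mul_nonneg (Real.exp_pos _).le (hp0 _)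
        rw [abs_of_nonneg (div_nonneg h4 hC0.le)]
        calc localPosterior p (R i) (a i) h / C
            ≤ Real.exp (-(1 / 16) * h ^ 2) * (2 * p a₀) / C := by
              unfold localPosterior
              gcongr
              exact hp0 _
          _ = _ := by ring
      · rw [indicator_of_notMem hh, abs_zero]; positivity
    · rw [centredGaussian, abs_of_nonneg (by positivity)]
      gcongr ?_ * ?_
      · gcongr
        nlinarith [Real.pi_pos]
      · refine Real.exp_le_exp.mpr ?_
        rw [div_le_iff₀ (by positivity)]
        nlinarith [sq_nonneg h]
  have hFlim : ∀ h, Tendsto (fun i => F i h) l (𝓝 0) := by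
    intro h
    have h0 : Tendsto (fun i => h / R i) l (𝓝 0) := hR.const_div_atTop h
    have l1 : Tendsto (fun i => localPosterior p (R i) (a i) h) l
        (𝓝 (Real.exp (-(h ^ 2 / 2)) * p a₀)) := by
      refine (Real.continuous_exp.continuousAt.tendsto.comp
        (tendsto_mul_profileLoss hR h).neg).mul (hpc.tendsto.comp ?_)
      simpa using ha.mul (h0.const_add 1)
    have l2 : Tendsto (fun i => centredGaussian (v i) h) l
        (𝓝 ((√(2 * Real.pi * 1))⁻¹ * Real.exp (-h ^ 2 / (2 * 1)))) := by
      refine Tendsto.mul (((hv.const_mul _).sqrt).inv₀ (by simpa using hsq.ne')) ?_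
      refine Real.continuous_exp.continuousAt.tendsto.comp ?_
      exact tendsto_const_nhds.div (hv.const_mul 2) (by norm_num)
    have l3 : Tendsto (fun i => localPosterior p (R i) (a i) h / C - centredGaussian (v i) h) l
        (𝓝 0) := by
      have := (l1.div_const C).sub l2
      convert this using 2
      rw [hC, mul_one, mul_one]
      have : -(h ^ 2 / 2) = -h ^ 2 / 2 := by ring
      rw [this]; field_simp; ring
    have l4 := l3.abs
    rw [abs_zero] at l4
    refine l4.congr' ?_
    have := (h0.abs).eventually_le_const (u := δ) (by simpa using hδ0)
    filter_upwards [this] with i hi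
    have hi' : h ∈ near i := hi
    simp only [F, indicator_of_mem hi']
  have hnearlim : Tendsto (fun i => ∫ h, F i h) l (𝓝 0) := by
    have := tendsto_integral_filter_of_dominated_convergence (μ := volume) bound
      (Eventually.of_forall hFmeas) (hFb.mono fun i hi => ae_of_all _ hi) hbound
      (ae_of_all _ hFlim)
    simpa using this
  -- the contribution of the complement of the neighbourhood
  let E : ι → ℝ := fun i =>
    Real.exp (-(R i ^ 2 * (δ ^ 2 / 16))) / C * (R i / a i * ∫ x, p x)
  have hElim : Tendsto E l (𝓝 0) := by
    have e1 : Tendsto (fun x : ℝ => x * Real.exp (-(δ ^ 2 / 16) * x ^ 2)) atTop (𝓝 0) := by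
      have hb : 0 < δ ^ 2 / 16 := by positivity
      have := (rpow_mul_exp_neg_mul_sq_isLittleO_exp_neg hb 1)
      have h2 : Tendsto (fun x : ℝ => Real.exp (-(1 / 2) * x)) atTop (𝓝 0) := by
        refine Real.tendsto_exp_atBot.comp ?_
        exact tendsto_id.const_mul_atTop_of_neg (by norm_num)
      simpa using this.trans_tendsto h2
    have e2 := (((e1.comp hR).div ha ha₀.ne').mul_const (∫ x, p x)).div_const C
    simp only [zero_div, zero_mul] at e2
    refine e2.congr fun i => ?_
    have : -(δ ^ 2 / 16) * R i ^ 2 = -(R i ^ 2 * (δ ^ 2 / 16)) := by ring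
    simp only [E, Pi.div_apply, Function.comp_apply, this]
    ring
  refine squeeze_zero' (Eventually.of_forall fun i => integral_nonneg fun h => abs_nonneg _)
    (g := fun i => (∫ h, F i h) + E i) ?_ ?_
  · filter_upwards [hFb, ev_a, hR.eventually_gt_atTop 0] with i hFi ⟨ha1, _, _⟩ hRi
    have hFint : Integrable (F i) := hbound.mono' (hFmeas i) (ae_of_all _ hFi)
    have hpint := (integrable_affine_comp hpi hRi ha1).const_mul
      (Real.exp (-(R i ^ 2 * (δ ^ 2 / 16))) / C)
    have hint : ∫ h, Real.exp (-(R i ^ 2 * (δ ^ 2 / 16))) / C * p (a i * (1 + h / R i)) = E i := by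
      rw [integral_const_mul, integral_affine_comp p hRi ha1]
    rw [← hint, ← integral_add hFint hpint]
    refine integral_mono_of_nonneg (ae_of_all _ fun h => abs_nonneg _) (hFint.add hpint)
      (ae_of_all _ fun h => ?_)
    have hlast : 0 ≤ Real.exp (-(R i ^ 2 * (δ ^ 2 / 16))) / C * p (a i * (1 + h / R i)) :=
      mul_nonneg (by positivity) (hp0 _)
    simp only [F]
    by_cases hh : h ∈ near i
    · rw [indicator_of_mem hh]; linarith
    · rw [indicator_of_notMem hh, zero_sub, abs_neg]
      have h1 : δ ≤ |h / R i| := (not_le.mp hh).le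
      have h2 := div_le_div_of_nonneg_right (localPosterior_le_far hp0 hpneg ha1 hδ0 hδ h1) hC0.le
      have h3 : 0 ≤ localPosterior p (R i) (a i) h / C :=
        div_nonneg (mul_nonneg (Real.exp_pos _).le (hp0 _)) hC0.le
      have h4 := abs_sub (localPosterior p (R i) (a i) h / C) (centredGaussian (v i) h)
      rw [abs_of_nonneg h3] at h4
      rw [mul_div_right_comm] at h2
      linarith
  · simpa using hnearlim.add hElim

/-! ### Total variation distance -/

lemma tvDist_le {μ ν : Measure ℝ} {c : ℝ}
    (h : ∀ A, MeasurableSet A → |μ.real A - ν.real A| ≤ c) : tvDist μ ν ≤ c :=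
  haveI : Nonempty {A : Set ℝ // MeasurableSet A} := ⟨⟨∅, MeasurableSet.empty⟩⟩
  ciSup_le fun A => h A.1 A.2

lemma withDensity_ofReal_real_apply {u : ℝ → ℝ} (hu0 : ∀ x, 0 ≤ u x) (hu : Integrable u)
    {A : Set ℝ} (hA : MeasurableSet A) :
    (volume.withDensity fun x => ENNReal.ofReal (u x)).real A = ∫ x in A, u x := by
  rw [measureReal_def, withDensity_apply _ hA,
    ← ofReal_integral_eq_lintegral_ofReal hu.integrableOn (ae_of_all _ hu0),
    ENNReal.toReal_ofReal (integral_nonneg hu0)]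

/-- An unnormalized density `u` that is close in `L¹` to a multiple `c g` of a probability density
has a normalization that is close to `g` in total variation, because the normalizing constant of
`u` is then close to `c`. -/
theorem tvDist_normalized_le {u g : ℝ → ℝ} (hu0 : ∀ x, 0 ≤ u x) (hu : Integrable u)
    (hg0 : ∀ x, 0 ≤ g x) (hg : Integrable g) (hg1 : ∫ x, g x = 1) {c : ℝ} (hc : 0 < c)
    (hE : ∫ x, |u x / c - g x| < 1) :
    tvDist
      (((volume.withDensity fun x => ENNReal.ofReal (u x)) univ)⁻¹ •
        volume.withDensity fun x => ENNReal.ofReal (u x))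
      (volume.withDensity fun x => ENNReal.ofReal (g x)) ≤ 2 * ∫ x, |u x / c - g x| := by
  set E := ∫ x, |u x / c - g x| with hEdef
  set Z := ∫ x, u x with hZ
  have hd : Integrable fun x => u x / c - g x := (hu.div_const c).sub hg
  have hZc : |Z / c - 1| ≤ E := by
    have : Z / c - 1 = ∫ x, (u x / c - g x) := by
      rw [integral_sub (hu.div_const c) hg, integral_div, hg1]
    rw [this]
    exact abs_integral_le_integral_abs
  have hZ0 : 0 < Z := by
    have h1 := (abs_le.mp hZc).1
    have : 0 < Z / c := by linarith
    exact (div_pos_iff_of_pos_right hc).mp this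
  refine tvDist_le fun A hA => ?_
  have hmass : ((volume.withDensity fun x => ENNReal.ofReal (u x)) univ).toReal = Z := by
    have := withDensity_ofReal_real_apply hu0 hu MeasurableSet.univ
    rwa [setIntegral_univ] at this
  rw [measureReal_ennreal_smul_apply, ENNReal.toReal_inv, hmass,
    withDensity_ofReal_real_apply hu0 hu hA, withDensity_ofReal_real_apply hg0 hg hA]
  have hA0 : 0 ≤ ∫ x in A, u x := integral_nonneg hu0
  have hA1 : ∫ x in A, u x ≤ Z := setIntegral_le_integral hu (ae_of_all _ hu0)
  have h1 : |(∫ x in A, u x) / c - ∫ x in A, g x| ≤ E := by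
    have : (∫ x in A, u x) / c - ∫ x in A, g x = ∫ x in A, (u x / c - g x) := by
      rw [integral_sub (hu.div_const c).integrableOn hg.integrableOn, integral_div]
    rw [this]
    exact abs_integral_le_integral_abs.trans
      (setIntegral_le_integral hd.abs (ae_of_all _ fun x => abs_nonneg _))
  have h2 : |Z⁻¹ * (∫ x in A, u x) - (∫ x in A, u x) / c| ≤ E := by
    have : Z⁻¹ * (∫ x in A, u x) - (∫ x in A, u x) / c
        = ((∫ x in A, u x) / Z) * (1 - Z / c) := by field_simp
    rw [this, abs_mul, abs_of_nonneg (by positivity), abs_sub_comm]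
    exact (mul_le_of_le_one_left (abs_nonneg _) ((div_le_one hZ0).mpr hA1)).trans hZc
  calc _ = |(Z⁻¹ * (∫ x in A, u x) - (∫ x in A, u x) / c)
        + ((∫ x in A, u x) / c - ∫ x in A, g x)| := by congr 1; ring
    _ ≤ E + E := (abs_add_le _ _).trans (add_le_add h2 h1)
    _ = 2 * E := by ring

lemma tvDist_map_sub_const (μ ν : Measure ℝ) (c : ℝ) :
    tvDist (μ.map fun x => x - c) (ν.map fun x => x - c) = tvDist μ ν := by
  have hm : Measurable fun x : ℝ => x - c := measurable_sub_const c
  have hm' : Measurable fun x : ℝ => x + c := measurable_add_const c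
  refine Function.Surjective.iSup_congr
    (fun A : {A : Set ℝ // MeasurableSet A} => ⟨(fun x => x - c) ⁻¹' A.1, hm A.2⟩)
    (fun A => ⟨⟨(fun x => x + c) ⁻¹' A.1, hm' A.2⟩, ?_⟩) (fun A => ?_)
  · ext x; simp
  · rw [map_measureReal_apply hm A.2, map_measureReal_apply hm A.2]

/-! ### The Bernstein–von Mises theorem for given values of the estimators -/

/-- The prior density, extended by `0` to the half-line of nonpositive numbers. -/
noncomputable def extendedPrior (π : ℝ → ℝ) : ℝ → ℝ := (Ioi (0 : ℝ)).indicator π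

section ExtendedPrior

variable {π : ℝ → ℝ}

lemma IsPriorDensity.measurable_extendedPrior (hπ : IsPriorDensity π) :
    Measurable (extendedPrior π) := hπ.measurable.indicator measurableSet_Ioi

lemma IsPriorDensity.extendedPrior_nonneg (hπ : IsPriorDensity π) (x : ℝ) :
    0 ≤ extendedPrior π x := indicator_nonneg (fun x hx => hπ.nonneg x hx) x

lemma extendedPrior_of_nonpos {x : ℝ} (hx : x ≤ 0) : extendedPrior π x = 0 :=
  indicator_of_notMem (by simpa using hx) _

lemma extendedPrior_of_pos {x : ℝ} (hx : 0 < x) : extendedPrior π x = π x :=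
  indicator_of_mem (mem_Ioi.mpr hx) _

lemma IsPriorDensity.integrable_extendedPrior (hπ : IsPriorDensity π) :
    Integrable (extendedPrior π) := by
  refine (integrable_indicator_iff measurableSet_Ioi).mpr ?_
  refine ⟨hπ.measurable.aestronglyMeasurable, ?_⟩
  rw [hasFiniteIntegral_iff_ofReal]
  · rw [hπ.mass]; exact ENNReal.one_lt_top
  · exact (ae_restrict_mem measurableSet_Ioi).mono fun x hx => hπ.nonneg x hx

end ExtendedPrior

/-- The tempered likelihood is, up to a constant factor, a power of the exponential of the profile
loss. The exponent is `n / (2 κ)`, with `κ = (s / a) ^ 2`. -/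
lemma likelihood_rpow_eq {T : ℝ} (hT : 0 < T) {n : ℕ} (hn : 0 < n) (x : Fin n → ℝ) {a s θ : ℝ}
    (ha : 0 < a) (hs : 0 < s) (hθ : 0 < θ) (hmle : mle T x = a) :
    likelihood T x θ ^ (1 / (s / a) ^ 2)
      = Real.exp (-(n * a ^ 2 / (2 * s ^ 2) * (Real.log a + 1)))
        * Real.exp (-(n * a ^ 2 / (2 * s ^ 2) * profileLoss (θ / a))) := by
  have hn' : (0 : ℝ) < n := by exact_mod_cast hn
  have hsum : ∑ i, x i ^ 2 = T * a := by
    rw [← hmle, mle]; field_simp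
  rw [likelihood, hsum, Real.rpow_def_of_pos hθ, ← Real.exp_add, ← Real.exp_mul, ← Real.exp_add]
  congr 1
  rw [profileLoss, Real.log_div hθ.ne' ha.ne']
  field_simp
  ring

lemma integral_abs_sub_gaussianPDFReal_eq {p : ℝ → ℝ} {R a C : ℝ} (hR : 0 < R) (ha : 0 < a)
    (hC : 0 < C) {v : ℝ≥0} (hv : v ≠ 0) :
    ∫ x, |Real.exp (-(R ^ 2 * profileLoss (x / a))) * p x / (a / R * C) - gaussianPDFReal a v x|
      = ∫ h, |localPosterior p R a h / C - centredGaussian (v * R ^ 2 / a ^ 2) h| := by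
  have hv0 : (0 : ℝ) < v := by
    have := pos_iff_ne_zero.mpr hv; exact_mod_cast this
  have h1 := integral_affine_comp (fun x => |Real.exp (-(R ^ 2 * profileLoss (x / a))) * p x /
    (a / R * C) - gaussianPDFReal a v x|) hR ha
  have h2 : ∀ G : ℝ, G = a / R * (R / a * G) := fun G => by field_simp
  rw [h2 (∫ x, |Real.exp (-(R ^ 2 * profileLoss (x / a))) * p x / (a / R * C)
    - gaussianPDFReal a v x|), ← h1, ← integral_const_mul]
  congr 1
  ext h
  have hRa : 0 < a / R := by positivity
  rw [← abs_of_pos hRa, ← abs_mul, abs_of_pos hRa]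
  congr 1
  have e1 : a * (1 + h / R) / a = 1 + h / R := by field_simp
  have e2 : √(2 * Real.pi * (v * R ^ 2 / a ^ 2)) = √(2 * Real.pi * v) * (R / a) := by
    rw [show 2 * Real.pi * (v * R ^ 2 / a ^ 2) = (2 * Real.pi * v) * (R / a) ^ 2 by ring,
      Real.sqrt_mul (by positivity), Real.sqrt_sq (by positivity)]
  have e3 : -(a * (1 + h / R) - a) ^ 2 / (2 * (v : ℝ)) = -h ^ 2 / (2 * (v * R ^ 2 / a ^ 2)) := by
    field_simp; ring
  have hsq : 0 < √(2 * Real.pi * v) := Real.sqrt_pos.mpr (by positivity)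
  rw [e1, gaussianPDFReal_def]
  simp only
  rw [e3, localPosterior, centredGaussian, e2]
  field_simp

/-- The total variation distance between the modified posterior and the normal distribution is
bounded by an `L¹` distance in the local parameter, that depends on the data through the values
`a` and `s` of the estimators `mle` and `mle - T⁻¹ jumpQV` only. -/
lemma normalDiscrepancy_le {T : ℝ} (hT : 0 < T) {π : ℝ → ℝ} (hπ : IsPriorDensity π) {θ : ℝ}
    (hθ : 0 < θ) {n : ℕ} (hn : 0 < n) (η : ℝ) (x : Fin n → ℝ) {a s : ℝ} (ha : 0 < a) (hs : 0 < s)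
    (hmle : mle T x = a) (hcont : a - T⁻¹ * jumpQV η x = s) {C E : ℝ} (hC : 0 < C)
    (hE : ∫ h, |localPosterior (extendedPrior π) (√(n / 2) * (a / s)) a h / C
      - centredGaussian (θ ^ 2 / s ^ 2) h| = E) (hE1 : E < 1) :
    normalDiscrepancy T π θ η x ≤ 2 * E := by
  have hn' : (0 : ℝ) < n := by exact_mod_cast hn
  set R := √((n : ℝ) / 2) * (a / s) with hRdef
  have hR : 0 < R := by positivity
  have hR2 : R ^ 2 = n * a ^ 2 / (2 * s ^ 2) := by
    rw [hRdef, mul_pow, Real.sq_sqrt (by positivity)]; ring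
  have hκ : temperature T η x = (s / a) ^ 2 := by
    rw [temperature, hmle, ← hcont]; field_simp
  set K := Real.exp (-(n * a ^ 2 / (2 * s ^ 2) * (Real.log a + 1))) with hK
  have hK0 : 0 < K := Real.exp_pos _
  set u : ℝ → ℝ := fun y =>
    K * (Real.exp (-(R ^ 2 * profileLoss (y / a))) * extendedPrior π y) with hu
  have hu0 : ∀ y, 0 ≤ u y := fun y =>
    mul_nonneg hK0.le (mul_nonneg (Real.exp_pos _).le (hπ.extendedPrior_nonneg y))
  have hp := hπ.integrable_extendedPrior
  have hui : Integrable u := by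
    refine Integrable.const_mul (hp.mono' ?_ (ae_of_all _ fun y => ?_)) K
    · have := hπ.measurable_extendedPrior
      exact Measurable.aestronglyMeasurable (by fun_prop)
    · rw [norm_mul, Real.norm_eq_abs, Real.norm_eq_abs, abs_of_pos (Real.exp_pos _),
        abs_of_nonneg (hπ.extendedPrior_nonneg y)]
      rcases le_or_gt y 0 with hy | hy
      · simp [extendedPrior_of_nonpos hy]
      · refine mul_le_of_le_one_left (hπ.extendedPrior_nonneg y) (Real.exp_le_one_iff.mpr ?_)
        have := (sq_nonneg _).trans (sq_inv_sqrt_sub_one_le_profileLoss (div_pos hy ha))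
        nlinarith [mul_nonneg (sq_nonneg R) this]
  have hpost : unnormalizedPosterior T π (temperature T η x) x
      = volume.withDensity fun y => ENNReal.ofReal (u y) := by
    rw [unnormalizedPosterior, ← withDensity_indicator measurableSet_Ioi]
    congr 1
    ext y
    rcases le_or_gt y 0 with hy | hy
    · rw [indicator_of_notMem (by simpa using hy), hu]
      simp [extendedPrior_of_nonpos hy]
    · rw [indicator_of_mem (mem_Ioi.mpr hy), hκ, likelihood_rpow_eq hT hn x ha hs hy hmle, hu]
      simp only
      rw [extendedPrior_of_pos hy, hR2, mul_assoc]
  have hv : (2 * θ ^ 2 / n).toNNReal ≠ 0 := by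
    have : 0 < 2 * θ ^ 2 / (n : ℝ) := by positivity
    simpa using this
  have hvR : ((2 * θ ^ 2 / n).toNNReal : ℝ) * R ^ 2 / a ^ 2 = θ ^ 2 / s ^ 2 := by
    rw [Real.coe_toNNReal _ (by positivity), hR2]; field_simp
  have hint : ∫ y, |u y / (K * (a / R * C)) - gaussianPDFReal a (2 * θ ^ 2 / n).toNNReal y|
      = E := by
    rw [← hE, ← hvR, ← integral_abs_sub_gaussianPDFReal_eq hR ha hC hv]
    congr 1; ext y; congr 2
    simp only [hu]
    rw [mul_div_mul_left _ _ hK0.ne']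
  have hmain := tvDist_normalized_le hu0 hui (fun y => gaussianPDFReal_nonneg a _ y)
    (integrable_gaussianPDFReal a _) (integral_gaussianPDFReal_eq_one a hv)
    (c := K * (a / R * C)) (by positivity) (by rw [hint]; exact hE1)
  rw [hint] at hmain
  rw [normalDiscrepancy, modifiedPosterior, hmle, ← gaussianReal_map_sub_const]
  refine (tvDist_map_sub_const _ _ _).le.trans (le_trans (le_of_eq ?_) hmain)
  rw [posterior, hpost, gaussianReal_of_var_ne_zero _ hv]
  rfl

/-- If the estimator `mle` is close to a point where the prior is continuous and positive, and
`mle - T⁻¹ jumpQV` is close to `θ`, then the modified posterior is close to normal. -/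
theorem exists_forall_normalDiscrepancy_le {T : ℝ} (hT : 0 < T) {π : ℝ → ℝ} (hπ : IsPriorDensity π)
    {θ : ℝ} (hθ : 0 < θ) {a₀ : ℝ} (ha₀ : 0 < a₀) (hcp : ContinuousPositiveNear π a₀) {ε : ℝ}
    (hε : 0 < ε) :
    ∃ δ > 0, ∃ N : ℕ, ∀ n ≥ N, ∀ (η : ℝ) (x : Fin n → ℝ), |mle T x - a₀| < δ →
      |mle T x - T⁻¹ * jumpQV η x - θ| < δ → normalDiscrepancy T π θ η x ≤ ε := by
  obtain ⟨hc, hpos⟩ := hcp.self_of_nhds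
  have hpa : 0 < extendedPrior π a₀ := by rwa [extendedPrior_of_pos ha₀]
  have hpc : ContinuousAt (extendedPrior π) a₀ := by
    refine hc.congr ?_
    filter_upwards [Ioi_mem_nhds ha₀] with y hy using (extendedPrior_of_pos hy).symm
  -- the parameters are the number of observations and the values of the two estimators
  let l : Filter (ℕ × ℝ × ℝ) := atTop ×ˢ (𝓝 a₀ ×ˢ 𝓝 θ)
  have ln : Tendsto (fun q : ℕ × ℝ × ℝ => q.1) l atTop := tendsto_fst
  have la : Tendsto (fun q : ℕ × ℝ × ℝ => q.2.1) l (𝓝 a₀) := tendsto_fst.comp tendsto_snd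
  have ls : Tendsto (fun q : ℕ × ℝ × ℝ => q.2.2) l (𝓝 θ) := tendsto_snd.comp tendsto_snd
  have lR : Tendsto (fun q : ℕ × ℝ × ℝ => √((q.1 : ℝ) / 2) * (q.2.1 / q.2.2)) l atTop := by
    refine Tendsto.atTop_mul_pos (div_pos ha₀ hθ) ?_ (la.div ls hθ.ne')
    exact Real.tendsto_sqrt_atTop.comp
      ((tendsto_natCast_atTop_atTop.comp ln).atTop_div_const (by norm_num))
  have lv : Tendsto (fun q : ℕ × ℝ × ℝ => θ ^ 2 / q.2.2 ^ 2) l (𝓝 1) := by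
    have := (tendsto_const_nhds (x := θ ^ 2)).div (ls.pow 2) (by positivity)
    rwa [div_self (by positivity)] at this
  have key := tendsto_integral_localPosterior_sub ha₀ lR la lv hπ.measurable_extendedPrior
    hπ.extendedPrior_nonneg (fun y hy => extendedPrior_of_nonpos hy) hπ.integrable_extendedPrior
    hpc hpa
  have hC : 0 < extendedPrior π a₀ * √(2 * Real.pi) :=
    mul_pos hpa (Real.sqrt_pos.mpr (by positivity))
  have hev := ((((key.eventually_lt_const (u := min 1 (ε / 2)) (by positivity)).and
    (ln.eventually_gt_atTop 0)).and (la.eventually_const_lt ha₀)).and (ls.eventually_const_lt hθ))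
  obtain ⟨s, hs, t, ht, hst⟩ := Filter.mem_prod_iff.mp hev
  obtain ⟨N, hN⟩ := mem_atTop_sets.mp hs
  rw [← nhds_prod_eq] at ht
  obtain ⟨δ, hδ, hball⟩ := Metric.mem_nhds_iff.mp ht
  refine ⟨δ, hδ, N, fun n hn η x h1 h2 => ?_⟩
  have hmem : (n, mle T x, mle T x - T⁻¹ * jumpQV η x) ∈ s ×ˢ t := by
    refine ⟨hN n hn, hball ?_⟩
    rw [Metric.mem_ball, Prod.dist_eq, max_lt_iff]
    exact ⟨h1, h2⟩
  obtain ⟨⟨⟨hE, hn0⟩, ha⟩, hs0⟩ := hst hmem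
  have := normalDiscrepancy_le hT hπ hθ hn0 η x ha hs0 rfl rfl hC rfl
    (hE.trans_le (min_le_left _ _))
  refine this.trans ?_
  have := hE.trans_le (min_le_right _ _)
  linarith

/-! ### Pure jump paths of finite activity on a fine grid -/

lemma startTime_le {T : ℝ≥0} (s : Horizon T) : startTime T ≤ s :=
  Subtype.mk_le_mk.mpr (zero_le (a := (s : ℝ≥0)))

/-- The jump of a pure jump path, computed from a representation of the path. -/
lemma jump_eq {T : ℝ≥0} {j : Horizon T → ℝ} {S : Finset (Horizon T)} {a : Horizon T → ℝ}
    (hS : ∀ s ∈ S, startTime T < s) (hj : ∀ t, j t = ∑ s ∈ S with s ≤ t, a s) (s : Horizon T) :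
    jump j s = if s ∈ S then a s else 0 := by
  classical
  rcases eq_or_lt_of_le (startTime_le s) with h0 | h0
  · have : s ∉ S := fun h => (hS s h).ne h0
    rw [if_neg this, jump, leftLim_eq_of_isBot (h0 ▸ startTime_le), sub_self]
  · have hne : (𝓝[<] s).NeBot := by
      refine mem_closure_iff_nhdsWithin_neBot.mp ?_
      rw [closure_Iio' (a := s) ⟨_, h0⟩]
      exact self_mem_Iic
    have hlim : Tendsto j (𝓝[<] s) (𝓝 (∑ u ∈ S with u < s, a u)) := by
      refine tendsto_const_nhds.congr' ?_
      have : ∀ u ∈ S, ∀ᶠ t in 𝓝[<] s, (u < s ↔ u ≤ t) := by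
        intro u _
        rcases lt_or_ge u s with h | h
        · filter_upwards [Ioo_mem_nhdsLT h] with t ht
          exact ⟨fun _ => ht.1.le, fun _ => h⟩
        · filter_upwards [self_mem_nhdsWithin] with t ht
          exact ⟨fun h' => absurd h' h.not_gt, fun h' => h'.trans_lt ht⟩
      filter_upwards [(Filter.eventually_all_finset S).mpr this] with t ht
      rw [hj t, Finset.filter_congr ht]
    rw [jump, leftLim_eq_of_tendsto hlim, hj s, sub_eq_iff_eq_add]
    by_cases hs : s ∈ S
    · rw [if_pos hs]
      have : S.filter (· ≤ s) = insert s (S.filter (· < s)) := by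
        ext u; simp only [Finset.mem_filter, Finset.mem_insert]
        constructor
        · rintro ⟨h1, h2⟩
          rcases h2.eq_or_lt with h | h
          · exact Or.inl h
          · exact Or.inr ⟨h1, h⟩
        · rintro (rfl | ⟨h1, h2⟩)
          · exact ⟨hs, le_rfl⟩
          · exact ⟨h1, h2.le⟩
      rw [this, Finset.sum_insert (by simp)]
    · rw [if_neg hs, zero_add]
      refine Finset.sum_congr (Finset.filter_congr fun u hu => ?_) fun _ _ => rfl
      exact ⟨fun h => lt_of_le_of_ne h fun e => hs (e ▸ hu), le_of_lt⟩

lemma quadVar_eq {T : ℝ≥0} {j : Horizon T → ℝ} {S : Finset (Horizon T)} {a : Horizon T → ℝ}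
    (hS : ∀ s ∈ S, startTime T < s) (hj : ∀ t, j t = ∑ s ∈ S with s ≤ t, a s) :
    quadVar j = ∑ s ∈ S, a s ^ 2 := by
  classical
  rw [quadVar, finsum_eq_sum_of_support_subset (s := S)]
  · exact Finset.sum_congr rfl fun s hs => by rw [jump_eq hS hj, if_pos hs]
  · intro s hs
    by_contra h
    refine hs ?_
    have h' : s ∉ S := h
    simp only [jump_eq hS hj, if_neg h']
    norm_num

lemma quadVar_nonneg {T : ℝ≥0} (j : Horizon T → ℝ) : 0 ≤ quadVar j :=
  finsum_nonneg fun _ => sq_nonneg _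

/-- The increment of a path over the `i`-th interval of the grid. -/
noncomputable def gridIncrement {T : ℝ≥0} (j : Horizon T → ℝ) (n : ℕ) (i : Fin n) : ℝ :=
  j (grid T n i.succ) - j (grid T n i.castSucc)

lemma coe_grid (T : ℝ≥0) (n : ℕ) (i : Fin (n + 1)) :
    (((grid T n i : Horizon T) : ℝ≥0) : ℝ) = i * T / n := by
  simp [grid]

lemma grid_mono (T : ℝ≥0) (n : ℕ) : Monotone (grid T n) := by
  intro i k hik
  refine Subtype.mk_le_mk.mpr ?_
  gcongr
  exact_mod_cast hik

/-- The intervals `(t_{i-1}, t_i]` of the grid cover `(0, T]`, without overlap. -/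
lemma existsUnique_mem_gridInterval {T : ℝ≥0} (hT : 0 < T) {n : ℕ} (hn : 0 < n) {s : Horizon T}
    (hs : startTime T < s) :
    ∃! i : Fin n, grid T n i.castSucc < s ∧ s ≤ grid T n i.succ := by
  have hT' : (0 : ℝ) < T := by exact_mod_cast hT
  have hn' : (0 : ℝ) < n := by exact_mod_cast hn
  have hs0 : (0 : ℝ) < ((s : ℝ≥0) : ℝ) := by
    have : (0 : ℝ≥0) < (s : ℝ≥0) := Subtype.mk_lt_mk.mp hs
    exact_mod_cast this
  have hsT : ((s : ℝ≥0) : ℝ) ≤ T := by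
    have : (s : ℝ≥0) ≤ T := s.2
    exact_mod_cast this
  set z : ℝ := ((s : ℝ≥0) : ℝ) * n / T with hz
  have key : ∀ i : Fin n, (grid T n i.castSucc < s ∧ s ≤ grid T n i.succ) ↔
      ((i : ℕ) : ℝ) < z ∧ z ≤ (i : ℕ) + 1 := by
    intro i
    rw [← Subtype.coe_lt_coe, ← Subtype.coe_le_coe, ← NNReal.coe_lt_coe, ← NNReal.coe_le_coe,
      coe_grid, coe_grid, hz, lt_div_iff₀ hT', div_lt_iff₀ hn', div_le_iff₀ hT', le_div_iff₀ hn']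
    simp
  have hz0 : 0 < z := by positivity
  have hzn : z ≤ n := by
    rw [hz, div_le_iff₀ hT', mul_comm]; gcongr
  have hc1 : 1 ≤ ⌈z⌉₊ := Nat.one_le_ceil_iff.mpr hz0
  have hc2 : ⌈z⌉₊ ≤ n := Nat.ceil_le.mpr hzn
  refine ⟨⟨⌈z⌉₊ - 1, by omega⟩, ?_, ?_⟩
  · simp only
    rw [key]
    simp only [Nat.cast_sub hc1, Nat.cast_one]
    constructor
    · linarith [Nat.ceil_lt_add_one hz0.le]
    · linarith [Nat.le_ceil z]
  · intro i hi
    rw [key] at hi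
    ext
    simp only
    have h1 : (i : ℕ) < ⌈z⌉₊ := Nat.lt_ceil.mpr hi.1
    have h2 : ⌈z⌉₊ ≤ (i : ℕ) + 1 := Nat.ceil_le.mpr (by push_cast; exact hi.2)
    omega

lemma gridIncrement_eq {T : ℝ≥0} {j : Horizon T → ℝ} {S : Finset (Horizon T)} {a : Horizon T → ℝ}
    (hj : ∀ t, j t = ∑ s ∈ S with s ≤ t, a s) (n : ℕ) (i : Fin n) :
    gridIncrement j n i
      = ∑ s ∈ S with grid T n i.castSucc < s ∧ s ≤ grid T n i.succ, a s := by
  classical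
  rw [gridIncrement, hj, hj, sub_eq_iff_eq_add, Finset.sum_filter, Finset.sum_filter,
    Finset.sum_filter, ← Finset.sum_add_distrib]
  refine Finset.sum_congr rfl fun s _ => ?_
  have hm : grid T n i.castSucc ≤ grid T n i.succ := grid_mono T n (Fin.castSucc_lt_succ).le
  rcases lt_or_ge (grid T n i.castSucc) s with h | h
  · simp [h, h.not_ge]
  · simp [h, h.not_gt, h.trans hm]

/-- On a sufficiently fine grid every interval contains at most one jump. Hence the nonzero
increments of a pure jump path are bounded away from zero, and their squares add up to the
quadratic variation. -/
theorem IsFinitePureJump.exists_eventually {T : ℝ≥0} (hT : 0 < T) {j : Horizon T → ℝ}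
    (hj : IsFinitePureJump j) :
    ∃ α > 0, ∀ᶠ n : ℕ in atTop, (∀ i, gridIncrement j n i ≠ 0 → α ≤ |gridIncrement j n i|) ∧
      ∑ i, gridIncrement j n i ^ 2 = quadVar j := by
  classical
  obtain ⟨S, a, hS, hj⟩ := hj
  have hα : ∃ α > 0, ∀ s ∈ S, a s ≠ 0 → α ≤ |a s| := by
    have : ∀ᶠ α in 𝓝[>] (0 : ℝ), ∀ s ∈ S, a s ≠ 0 → α ≤ |a s| := by
      refine (Filter.eventually_all_finset S).mpr fun s _ => ?_
      by_cases h : a s = 0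
      · simp [h]
      · filter_upwards [Ioo_mem_nhdsGT (abs_pos.mpr h)] with α hα _ using hα.2.le
    obtain ⟨α, h1, h2⟩ := (this.and self_mem_nhdsWithin).exists
    exact ⟨α, h2, h1⟩
  obtain ⟨α, hα0, hα⟩ := hα
  refine ⟨α, hα0, ?_⟩
  have hsep : ∀ᶠ n : ℕ in atTop, ∀ s ∈ S, ∀ u ∈ S, s < u →
      (T : ℝ) / n < ((u : ℝ≥0) : ℝ) - ((s : ℝ≥0) : ℝ) := by
    refine (Filter.eventually_all_finset S).mpr fun s _ =>
      (Filter.eventually_all_finset S).mpr fun u _ => ?_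
    by_cases h : s < u
    · have h' : ((s : ℝ≥0) : ℝ) < ((u : ℝ≥0) : ℝ) := by exact_mod_cast h
      filter_upwards [(tendsto_const_div_atTop_nhds_zero_nat (T : ℝ)).eventually_lt_const
        (sub_pos.mpr h')] with n hn _ using hn
    · simp [h]
  filter_upwards [hsep, eventually_gt_atTop 0] with n hn hn0
  have hn' : (0 : ℝ) < n := by exact_mod_cast hn0
  set I : Fin n → Finset (Horizon T) :=
    fun i => S.filter fun s => grid T n i.castSucc < s ∧ s ≤ grid T n i.succ with hI
  have hlen : ∀ i, ∀ s ∈ I i, ∀ u ∈ I i, ¬ s < u := by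
    intro i s hs u hu hsu
    simp only [hI, Finset.mem_filter] at hs hu
    have h1 := hn s hs.1 u hu.1 hsu
    have h2 : (((grid T n i.castSucc : Horizon T) : ℝ≥0) : ℝ) < ((s : ℝ≥0) : ℝ) := by
      exact_mod_cast hs.2.1
    have h3 : ((u : ℝ≥0) : ℝ) ≤ (((grid T n i.succ : Horizon T) : ℝ≥0) : ℝ) := by
      exact_mod_cast hu.2.2
    rw [coe_grid] at h2 h3
    have h4 : ((i.succ : ℕ) : ℝ) * T / n = ((i.castSucc : ℕ) : ℝ) * T / n + T / n := by
      simp only [Fin.val_succ, Fin.val_castSucc]; push_cast; ring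
    linarith
  have hI1 : ∀ i, I i = ∅ ∨ ∃ s ∈ S, I i = {s} := by
    intro i
    rcases (I i).eq_empty_or_nonempty with h | ⟨s, hs⟩
    · exact Or.inl h
    · refine Or.inr ⟨s, (Finset.mem_filter.mp hs).1, Finset.eq_singleton_iff_unique_mem.mpr
        ⟨hs, fun u hu => ?_⟩⟩
      exact le_antisymm (not_lt.mp (hlen i s hs u hu)) (not_lt.mp (hlen i u hu s hs))
  have hd : ∀ i, gridIncrement j n i = ∑ s ∈ I i, a s := fun i => gridIncrement_eq hj n i
  refine ⟨fun i hi => ?_, ?_⟩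
  · rcases hI1 i with h | ⟨s, hs, h⟩
    · rw [hd, h] at hi; simp at hi
    · rw [hd, h, Finset.sum_singleton] at hi ⊢
      exact hα s hs hi
  · have h1 : ∀ i, gridIncrement j n i ^ 2 = ∑ s ∈ I i, a s ^ 2 := by
      intro i
      rcases hI1 i with h | ⟨s, hs, h⟩ <;> rw [hd, h] <;> simp
    rw [quadVar_eq hS hj, Finset.sum_congr rfl fun i _ => h1 i]
    simp only [hI, Finset.sum_filter]
    rw [Finset.sum_comm]
    refine Finset.sum_congr rfl fun s hs => ?_
    obtain ⟨i, hi, huniq⟩ := existsUnique_mem_gridInterval hT hn0 (hS s hs)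
    rw [Finset.sum_eq_single i, if_pos hi]
    · intro k _ hk
      rw [if_neg fun h => hk (huniq k h)]
    · simp

/-! ### The estimators for increments with small continuous part -/

/-- Let `x = y + d`, where the `y i` are so small that thresholding `|x i|` at `η` detects exactly
the nonzero `d i`. Then thresholding removes the jumps, up to the square of the size of `y`, and the
cross terms between `y` and `d` are negligible. The number of nonzero `d i` does not appear because
it is at most `α⁻² ∑ d i ^ 2`. -/
lemma sums_of_small_continuous_part {n : ℕ} {x y d : Fin n → ℝ} (hx : ∀ i, x i = y i + d i)
    {ρ α η : ℝ} (hρ : 0 ≤ ρ) (hα : 0 < α) (hy : ∀ i, |y i| ≤ ρ) (hρη : ρ ≤ η) (hηα : η + ρ < α)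
    (hd : ∀ i, d i ≠ 0 → α ≤ |d i|) :
    |∑ i, x i ^ 2 - jumpQV η x - ∑ i, y i ^ 2| ≤ ρ ^ 2 * (∑ i, d i ^ 2) / α ^ 2 ∧
      |∑ i, x i ^ 2 - ∑ i, y i ^ 2 - ∑ i, d i ^ 2| ≤ 2 * ρ * (∑ i, d i ^ 2) / α := by
  constructor
  · rw [jumpQV, ← Finset.sum_sub_distrib, ← Finset.sum_sub_distrib, Finset.mul_sum,
      Finset.sum_div]
    refine (Finset.abs_sum_le_sum_abs _ _).trans (Finset.sum_le_sum fun i _ => ?_)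
    by_cases h : d i = 0
    · have : ¬ η < |x i| := by
        rw [hx, h, add_zero]; exact not_lt.mpr ((hy i).trans hρη)
      rw [if_neg this, hx, h]; simp
    · have h1 := hd i h
      have : η < |x i| := by
        have h2 : |d i| ≤ |x i| + |y i| := by
          have : d i = x i - y i := by rw [hx]; ring
          rw [this]; exact abs_sub _ _
        linarith [hy i]
      rw [if_pos this, sub_self, zero_sub, abs_neg, abs_of_nonneg (sq_nonneg _), ← sq_abs,
        ← sq_abs (d i), mul_div_assoc]
      refine (pow_le_pow_left₀ (abs_nonneg _) (hy i) 2).trans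
        (le_mul_of_one_le_right (by positivity) ?_)
      rw [one_le_div (by positivity)]
      exact pow_le_pow_left₀ hα.le h1 2
  · rw [← Finset.sum_sub_distrib, ← Finset.sum_sub_distrib, Finset.mul_sum, Finset.sum_div]
    refine (Finset.abs_sum_le_sum_abs _ _).trans (Finset.sum_le_sum fun i _ => ?_)
    have : x i ^ 2 - y i ^ 2 - d i ^ 2 = 2 * (y i * d i) := by rw [hx]; ring
    rw [this, abs_mul, abs_mul, abs_two, mul_assoc 2 ρ, mul_div_assoc, mul_div_assoc]
    gcongr
    · exact hy i
    · by_cases h : d i = 0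
      · simp [h]
      · rw [le_div_iff₀ hα, ← sq_abs, sq]
        gcongr
        exact hd i h

/-! ### Increments of Brownian motion -/

lemma measurable_path {Ω : Type*} [MeasurableSpace Ω] {T : ℝ≥0} {Y : Horizon T → Ω → ℝ}
    (hY : ∀ t, Measurable (Y t)) : Measurable (path Y) := measurable_pi_lambda _ hY

lemma measurable_gridIncrement (T : ℝ≥0) (n : ℕ) (i : Fin n) :
    Measurable fun j : Horizon T → ℝ => gridIncrement j n i :=
  (measurable_pi_apply _).sub (measurable_pi_apply _)

lemma IsBrownianOn.hasLaw_gridIncrement {Ω : Type*} [MeasurableSpace Ω] {P : Measure Ω} {T : ℝ≥0}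
    {W : Horizon T → Ω → ℝ} (hW : IsBrownianOn T W P) (n : ℕ) (i : Fin n) :
    HasLaw (fun ω => gridIncrement (path W ω) n i) (gaussianReal 0 (T / n)) P := by
  have h := hW.law (grid T n i.castSucc) (grid T n i.succ)
    (grid_mono T n (Fin.castSucc_lt_succ).le)
  have e : ((grid T n i.succ : Horizon T) : ℝ≥0) - ((grid T n i.castSucc : Horizon T) : ℝ≥0)
      = T / n := by
    simp only [grid, Fin.val_succ, Fin.val_castSucc]
    rw [tsub_eq_iff_eq_add_of_le (by gcongr; simp), ← add_div]
    congr 1; push_cast; ring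
  rw [e] at h
  exact h

/-- A Gaussian tail bound. -/
lemma measure_le_abs_of_hasLaw_gaussianReal {Ω : Type*} [MeasurableSpace Ω] {P : Measure Ω}
    [IsProbabilityMeasure P] {X : Ω → ℝ} {v : ℝ≥0} (hX : HasLaw X (gaussianReal 0 v) P) {c : ℝ}
    (hc : 0 ≤ c) : P.real {ω | c ≤ |X ω|} ≤ 2 * Real.exp (-c ^ 2 / (2 * v)) := by
  have hs : HasSubgaussianMGF X v P := by
    refine ⟨fun t => ?_, fun t => ?_⟩
    · have h := integrable_exp_mul_gaussianReal (μ := 0) (v := v) t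
      rw [← hX.map_eq] at h
      exact (integrable_map_measure (by fun_prop) hX.aemeasurable).mp h
    · rw [mgf_gaussianReal hX.map_eq, zero_mul, zero_add]
  have h1 := hs.measure_ge_le hc
  have h2 := hs.neg.measure_ge_le hc
  have hsub : {ω | c ≤ |X ω|} ⊆ {ω | c ≤ X ω} ∪ {ω | c ≤ (-X) ω} := by
    intro ω hω
    exact le_abs.mp (show c ≤ |X ω| from hω)
  calc P.real {ω | c ≤ |X ω|} ≤ P.real ({ω | c ≤ X ω} ∪ {ω | c ≤ (-X) ω}) :=
        measureReal_mono hsub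
    _ ≤ P.real {ω | c ≤ X ω} + P.real {ω | c ≤ (-X) ω} := measureReal_union_le _ _
    _ ≤ _ := by linarith

/-- The modulus of continuity of Brownian motion on the grid is smaller than any multiple of
`n ^ (-r)` with `r < 1 / 2`. -/
theorem IsBrownianOn.tendsto_measure_exists_le_abs {Ω : Type*} [MeasurableSpace Ω] {P : Measure Ω}
    [IsProbabilityMeasure P] {T : ℝ≥0} (hT : 0 < T) {W : Horizon T → Ω → ℝ}
    (hW : IsBrownianOn T W P) {c r : ℝ} (hc : 0 < c) (hr : r < 1 / 2) :
    Tendsto (fun n : ℕ => P {ω | ∃ i : Fin n, c * (n : ℝ) ^ (-r) ≤ |gridIncrement (path W ω) n i|})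
      atTop (𝓝 0) := by
  have hT' : (0 : ℝ) < T := by exact_mod_cast hT
  have hb : ∀ n : ℕ, 0 < n →
      P {ω | ∃ i : Fin n, c * (n : ℝ) ^ (-r) ≤ |gridIncrement (path W ω) n i|}
      ≤ ENNReal.ofReal (2 * (n * Real.exp (-(c ^ 2 / (2 * T)) * (n : ℝ) ^ (1 - 2 * r)))) := by
    intro n hn
    have hn' : (0 : ℝ) < n := by exact_mod_cast hn
    rw [ofPred_exists, ← ofReal_measureReal]
    refine ENNReal.ofReal_le_ofReal ((measureReal_iUnion_fintype_le _).trans ?_)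
    refine (Finset.sum_le_sum fun i _ => measure_le_abs_of_hasLaw_gaussianReal
      (hW.hasLaw_gridIncrement n i) (by positivity)).trans (le_of_eq ?_)
    rw [Finset.sum_const, Finset.card_univ, Fintype.card_fin, nsmul_eq_mul]
    have e : -(c * (n : ℝ) ^ (-r)) ^ 2 / (2 * ((T / n : ℝ≥0) : ℝ))
        = -(c ^ 2 / (2 * T)) * (n : ℝ) ^ (1 - 2 * r) := by
      have h1 : (n : ℝ) ^ (1 - 2 * r) = n * ((n : ℝ) ^ (-r)) ^ 2 := by
        rw [← Real.rpow_natCast, ← Real.rpow_mul hn'.le, sub_eq_add_neg, Real.rpow_add hn',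
          Real.rpow_one]
        congr 2; push_cast; ring
      rw [h1]; push_cast; field_simp
    rw [e]; ring
  have hlim : Tendsto (fun n : ℕ =>
      2 * (n * Real.exp (-(c ^ 2 / (2 * T)) * (n : ℝ) ^ (1 - 2 * r)))) atTop (𝓝 0) := by
    have hs : 0 < 1 - 2 * r := by linarith
    have hk : 0 < c ^ 2 / (2 * T : ℝ) := by positivity
    have h1 := tendsto_rpow_mul_exp_neg_mul_atTop_nhds_zero (1 / (1 - 2 * r)) _ hk
    have h2 : Tendsto (fun n : ℕ => (n : ℝ) ^ (1 - 2 * r)) atTop atTop :=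
      (tendsto_rpow_atTop hs).comp tendsto_natCast_atTop_atTop
    have h3 := (h1.comp h2).const_mul 2
    rw [mul_zero] at h3
    refine h3.congr fun n => ?_
    simp only [Function.comp_apply]
    rw [← Real.rpow_mul (Nat.cast_nonneg n), mul_one_div_cancel hs.ne', Real.rpow_one]
  have hlim' := ENNReal.tendsto_ofReal hlim
  rw [ENNReal.ofReal_zero] at hlim'
  refine tendsto_of_tendsto_of_tendsto_of_le_of_le' tendsto_const_nhds hlim'
    (Eventually.of_forall fun _ => zero_le) ?_
  filter_upwards [eventually_gt_atTop 0] with n hn using hb n hn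

/-- The fourth moment scales with the square of the variance. -/
lemma integral_pow_four_gaussianReal (v : ℝ≥0) :
    ∫ x, x ^ 4 ∂gaussianReal 0 v = v ^ 2 * ∫ x, x ^ 4 ∂gaussianReal 0 1 := by
  have h : gaussianReal 0 v = (gaussianReal 0 1).map (fun x => √v * x) := by
    rw [gaussianReal_map_const_mul, mul_zero, mul_one]
    congr 1
    ext; simp
  rw [h, integral_map (by fun_prop) (by fun_prop), ← integral_const_mul]
  congr 1; ext x
  rw [mul_pow]
  congr 1
  rw [show 4 = 2 * 2 by rfl, pow_mul, Real.sq_sqrt v.coe_nonneg]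

/-- The realized quadratic variation of Brownian motion converges in probability. -/
theorem IsBrownianOn.tendsto_measure_quadraticVariation {Ω : Type*} [MeasurableSpace Ω]
    {P : Measure Ω} [IsProbabilityMeasure P] {T : ℝ≥0} {W : Horizon T → Ω → ℝ}
    (hW : IsBrownianOn T W P) {ε : ℝ} (hε : 0 < ε) :
    Tendsto (fun n : ℕ => P {ω | ε ≤ |∑ i : Fin n, gridIncrement (path W ω) n i ^ 2 - T|})
      atTop (𝓝 0) := by
  set C := ∫ x, x ^ 4 ∂gaussianReal 0 1 with hC
  have hb : ∀ n : ℕ, 0 < n →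
      P {ω | ε ≤ |∑ i : Fin n, gridIncrement (path W ω) n i ^ 2 - T|}
      ≤ ENNReal.ofReal (C * T ^ 2 / ε ^ 2 / n) := by
    intro n hn
    have hn' : (n : ℝ) ≠ 0 := by positivity
    set X : Fin n → Ω → ℝ := fun i ω => gridIncrement (path W ω) n i ^ 2 with hX
    have hlaw := fun i : Fin n => hW.hasLaw_gridIncrement n i
    have hmem4 : ∀ i : Fin n, MemLp (fun ω => gridIncrement (path W ω) n i) 4 P := by
      intro i
      have := memLp_id_gaussianReal' (μ := 0) (v := T / n) 4 (by simp)
      rw [← (hlaw i).map_eq] at this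
      exact (memLp_map_measure_iff (by fun_prop) (hlaw i).aemeasurable).mp this
    have hmem : ∀ i, MemLp (X i) 2 P := by
      intro i
      have h : AEStronglyMeasurable (X i) P :=
        ((hlaw i).aemeasurable.pow_const 2).aestronglyMeasurable
      rw [memLp_two_iff_integrable_sq h]
      have := (hmem4 i).integrable_norm_pow (p := 4) (by norm_num)
      refine this.congr (ae_of_all _ fun ω => ?_)
      simp only [hX, Real.norm_eq_abs]
      rw [← pow_mul, Even.pow_abs (by decide)]
    have hexp : ∀ i, ∫ ω, X i ω ∂P = T / n := by
      intro i
      have h1 : ∫ ω, X i ω ∂P = ∫ x, x ^ 2 ∂gaussianReal 0 (T / n) := by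
        rw [← (hlaw i).map_eq, integral_map (hlaw i).aemeasurable (by fun_prop)]
      have h2 := variance_fun_id_gaussianReal (μ := 0) (v := T / n)
      rw [variance_of_integral_eq_zero (by fun_prop) (by simp)] at h2
      rw [h1, h2]; simp
    have hvar : ∀ i, Var[X i; P] ≤ C * T ^ 2 / n ^ 2 := by
      intro i
      have hm := (hmem i).aestronglyMeasurable
      refine (variance_le_expectation_sq hm).trans (le_of_eq ?_)
      have h1 : ∫ ω, (X i ^ 2) ω ∂P = ∫ x, x ^ 4 ∂gaussianReal 0 (T / n) := by
        rw [← (hlaw i).map_eq, integral_map (hlaw i).aemeasurable (by fun_prop)]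
        congr 1; ext ω
        simp only [hX, Pi.pow_apply]; ring
      rw [h1, integral_pow_four_gaussianReal]
      push_cast
      rw [← hC]; ring
    have hind : iIndepFun X P :=
      (hW.indep n (grid T n) (grid_mono T n)).comp (fun _ x => x ^ 2) (fun _ => by fun_prop)
    have hsumvar : Var[∑ i, X i; P] ≤ C * T ^ 2 / n := by
      rw [IndepFun.variance_sum (fun i _ => hmem i) (fun i _ k _ hik => hind.indepFun hik)]
      refine (Finset.sum_le_sum fun i _ => hvar i).trans (le_of_eq ?_)
      rw [Finset.sum_const, Finset.card_univ, Fintype.card_fin, nsmul_eq_mul]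
      field_simp
    have hsumexp : ∫ ω, (∑ i, X i) ω ∂P = T := by
      simp only [Finset.sum_apply]
      rw [integral_finsetSum _ fun i _ => (hmem i).integrable (by norm_num)]
      rw [Finset.sum_congr rfl fun i _ => hexp i, Finset.sum_const, Finset.card_univ,
        Fintype.card_fin, nsmul_eq_mul]
      field_simp
    have hcheb := meas_ge_le_variance_div_sq (memLp_finsetSum' _ fun i _ => hmem i) hε
      (X := ∑ i, X i)
    rw [hsumexp] at hcheb
    simp only [Finset.sum_apply] at hcheb
    refine hcheb.trans (ENNReal.ofReal_le_ofReal ?_)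
    rw [div_right_comm]
    gcongr
  have hlim := ENNReal.tendsto_ofReal (tendsto_const_div_atTop_nhds_zero_nat (C * T ^ 2 / ε ^ 2))
  rw [ENNReal.ofReal_zero] at hlim
  refine tendsto_of_tendsto_of_tendsto_of_le_of_le' tendsto_const_nhds hlim
    (Eventually.of_forall fun _ => zero_le) ?_
  filter_upwards [eventually_gt_atTop 0] with n hn using hb n hn

/-! ### Conditioning on the jump process -/

/-- If `X` and `Y` are independent, then the conditional distribution of `f (X, Y)` given `Y = y`
is the distribution of `f (X, y)`. -/
theorem condDistrib_comp_ae_eq_of_indepFun {Ω α β γ : Type*} [MeasurableSpace Ω]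
    [MeasurableSpace α] [MeasurableSpace β] [MeasurableSpace γ] [StandardBorelSpace γ] [Nonempty γ]
    {P : Measure Ω} [IsProbabilityMeasure P] {X : Ω → α} {Y : Ω → β} (hX : Measurable X)
    (hY : Measurable Y) (hXY : IndepFun X Y P) {f : α × β → γ} (hf : Measurable f) :
    ∀ᵐ y ∂P.map Y, condDistrib (fun ω => f (X ω, Y ω)) Y P y = P.map fun ω => f (X ω, y) := by
  have : IsProbabilityMeasure (P.map X) := Measure.isProbabilityMeasure_map hX.aemeasurable
  have : IsProbabilityMeasure (P.map Y) := Measure.isProbabilityMeasure_map hY.aemeasurable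
  let κ : Kernel β γ := ((Kernel.const β (P.map X)) ×ₖ Kernel.id).map f
  have hκ : ∀ y, κ y = P.map fun ω => f (X ω, y) := by
    intro y
    rw [Kernel.map_apply _ hf, Kernel.prod_apply, Kernel.const_apply, Kernel.id_apply,
      Measure.prod_dirac, Measure.map_map hf (by fun_prop), Measure.map_map (by fun_prop) hX]
    rfl
  have : IsMarkovKernel κ := Kernel.IsMarkovKernel.map _ hf
  have key : P.map (fun ω => (Y ω, f (X ω, Y ω))) = P.map Y ⊗ₘ κ := by
    ext s hs
    have hg : Measurable fun q : α × β => (q.2, f q) := by fun_prop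
    have h1 : P.map (fun ω => (Y ω, f (X ω, Y ω)))
        = ((P.map X).prod (P.map Y)).map fun q => (q.2, f q) := by
      rw [← (indepFun_iff_map_prod_eq_prod_map_map hX.aemeasurable hY.aemeasurable).mp hXY,
        Measure.map_map hg (hX.prodMk hY)]
      rfl
    rw [h1, Measure.map_apply hg hs, Measure.prod_apply_symm (hg hs), Measure.compProd_apply hs]
    refine lintegral_congr fun y => ?_
    have hy : Measurable fun ω => f (X ω, y) := by fun_prop
    rw [hκ, Measure.map_apply hy (measurable_prodMk_left hs),
      Measure.map_apply hX (measurable_prodMk_right (hg hs))]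
    rfl
  filter_upwards [condDistrib_ae_eq_of_measure_eq_compProd Y
    (hf.comp (hX.prodMk hY)).aemeasurable key] with y hy
  rw [← hκ y]; exact hy

/-- The observed differences when the paths of Brownian motion and of the jump process are
`w` and `j`. -/
noncomputable def pathIncrements {T : ℝ≥0} (β θ : ℝ) (n : ℕ) (w j : Horizon T → ℝ) : Fin n → ℝ :=
  fun i => (β * (T / n) + √θ * gridIncrement w n i) + gridIncrement j n i

lemma increments_eq {Ω : Type*} {T : ℝ≥0} (β θ : ℝ) (W J : Horizon T → Ω → ℝ) (n : ℕ) :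
    increments β θ W J n = fun ω => pathIncrements β θ n (path W ω) (path J ω) := by
  ext ω i
  simp only [increments, diffusion, pathIncrements, gridIncrement, path, coe_grid, Fin.val_succ,
    Fin.val_castSucc]
  push_cast
  ring

lemma measurable_pathIncrements {T : ℝ≥0} (β θ : ℝ) (n : ℕ) :
    Measurable fun q : (Horizon T → ℝ) × (Horizon T → ℝ) => pathIncrements β θ n q.1 q.2 := by
  refine measurable_pi_lambda _ fun i => ?_
  have h1 : Measurable fun q : (Horizon T → ℝ) × (Horizon T → ℝ) => gridIncrement q.1 n i :=
    (measurable_gridIncrement T n i).comp measurable_fst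
  have h2 : Measurable fun q : (Horizon T → ℝ) × (Horizon T → ℝ) => gridIncrement q.2 n i :=
    (measurable_gridIncrement T n i).comp measurable_snd
  exact (measurable_const.add (h1.const_mul _)).add h2

/-! ### Consistency of the estimators -/

lemma measurable_mle (T : ℝ) (n : ℕ) : Measurable fun x : Fin n → ℝ => mle T x := by
  unfold mle; fun_prop

lemma measurable_jumpQV (η : ℝ) (n : ℕ) : Measurable fun x : Fin n → ℝ => jumpQV η x := by
  unfold jumpQV
  refine Finset.measurable_sum _ fun i _ => ?_
  exact Measurable.ite (measurableSet_lt measurable_const (by fun_prop)) (by fun_prop)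
    measurable_const

/-- Both estimators are consistent, for every path `j` of the jump process. -/
theorem IsBrownianOn.tendsto_measure_estimators {Ω : Type*} [MeasurableSpace Ω] {P : Measure Ω}
    [IsProbabilityMeasure P] {T : ℝ≥0} (hT : 0 < T) {W : Horizon T → Ω → ℝ}
    (hW : IsBrownianOn T W P) (β : ℝ) {θ : ℝ} (hθ : 0 < θ) {m r : ℝ} (hm : 0 < m) (hr0 : 0 < r)
    (hr1 : r < 1 / 2) {j : Horizon T → ℝ} (hj : IsFinitePureJump j) {δ : ℝ} (hδ : 0 < δ) :
    Tendsto (fun n : ℕ => P {ω | ¬ (|mle T (pathIncrements β θ n (path W ω) j)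
          - (θ + (T : ℝ)⁻¹ * quadVar j)| < δ ∧
        |mle T (pathIncrements β θ n (path W ω) j)
          - (T : ℝ)⁻¹ * jumpQV (m * (n : ℝ) ^ (-r)) (pathIncrements β θ n (path W ω) j) - θ| < δ)})
      atTop (𝓝 0) := by
  have hT' : (0 : ℝ) < T := by exact_mod_cast hT
  obtain ⟨α, hα, hev⟩ := hj.exists_eventually hT
  set q := quadVar j
  have hsθ : 0 < √θ := Real.sqrt_pos.mpr hθ
  set c := m / (2 * √θ) with hc
  have hc0 : 0 < c := by positivity
  have hε : 0 < T * δ / (2 * θ) := by positivity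
  have hsum := (hW.tendsto_measure_exists_le_abs hT hc0 hr1).add
    (hW.tendsto_measure_quadraticVariation hε)
  rw [add_zero] at hsum
  -- `ρ` bounds the increments of the continuous part
  set b : ℕ → ℝ := fun n => β * (T / n) with hb
  set ρ : ℕ → ℝ := fun n => |b n| + m / 2 * (n : ℝ) ^ (-r) with hρ
  have lpow : Tendsto (fun n : ℕ => (n : ℝ) ^ (-r)) atTop (𝓝 0) :=
    (tendsto_rpow_neg_atTop hr0).comp tendsto_natCast_atTop_atTop
  have lb : Tendsto b atTop (𝓝 0) := by
    simpa using (tendsto_const_div_atTop_nhds_zero_nat (T : ℝ)).const_mul β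
  have lρ : Tendsto ρ atTop (𝓝 0) := by simpa using lb.abs.add (lpow.const_mul (m / 2))
  have lη : Tendsto (fun n : ℕ => m * (n : ℝ) ^ (-r)) atTop (𝓝 0) := by
    simpa using lpow.const_mul m
  -- the drift is negligible with respect to the threshold because `r < 1`
  have ebη : ∀ᶠ n : ℕ in atTop, |b n| ≤ m / 2 * (n : ℝ) ^ (-r) := by
    have l1 : Tendsto (fun n : ℕ => |β| * T * (n : ℝ) ^ (-(1 - r))) atTop (𝓝 0) := by
      simpa using ((tendsto_rpow_neg_atTop (by linarith : 0 < 1 - r)).comp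
        tendsto_natCast_atTop_atTop).const_mul (|β| * T)
    filter_upwards [l1.eventually_le_const (by positivity : 0 < m / 2), eventually_gt_atTop 0]
      with n h1 hn
    have hn' : (0 : ℝ) < n := by exact_mod_cast hn
    have e : |b n| = |β| * T * (n : ℝ) ^ (-(1 - r)) * (n : ℝ) ^ (-r) := by
      rw [mul_assoc, ← Real.rpow_add hn', hb]
      simp only
      rw [abs_mul, abs_of_pos (by positivity : (0 : ℝ) < T / n),
        show -(1 - r) + -r = -1 by ring, Real.rpow_neg_one]
      ring
    rw [e]
    gcongr
  set G : ℕ → ℝ := fun n => ρ n ^ 2 * q / α ^ 2 + 2 * ρ n * q / α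
    + (|β| * T * |b n| + 2 * (|β| * T) * ρ n) with hG
  have lG : Tendsto G atTop (𝓝 0) := by
    have h1 := (((lρ.pow 2).mul_const q).div_const (α ^ 2)).add
      (((lρ.const_mul 2).mul_const q).div_const α)
    have h2 := (lb.abs.const_mul (|β| * T)).add (lρ.const_mul (2 * (|β| * T)))
    simpa using h1.add h2
  refine tendsto_of_tendsto_of_tendsto_of_le_of_le' tendsto_const_nhds hsum
    (Eventually.of_forall fun _ => zero_le) ?_
  have lηρ : Tendsto (fun n : ℕ => m * (n : ℝ) ^ (-r) + ρ n) atTop (𝓝 0) := by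
    simpa using lη.add lρ
  filter_upwards [hev, ebη, lG.eventually_lt_const (by positivity : 0 < T * δ / 2),
    lηρ.eventually_lt_const hα, eventually_gt_atTop 0] with n ⟨hd, hdq⟩ hbη hGn hηα hn
  refine (measure_mono fun ω hω => ?_).trans (measure_union_le _ _)
  have hn' : (0 : ℝ) < n := by exact_mod_cast hn
  by_contra hbad
  rw [mem_union, not_or] at hbad
  obtain ⟨h1, h2⟩ := hbad
  simp only [mem_ofPred_eq, not_exists, not_le] at h1 h2
  refine hω ?_
  set ξ : Fin n → ℝ := fun i => gridIncrement (path W ω) n i with hξ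
  set x := pathIncrements β θ n (path W ω) j with hx
  set y : Fin n → ℝ := fun i => b n + √θ * ξ i with hy
  have hξb : ∀ i, |√θ * ξ i| ≤ m / 2 * (n : ℝ) ^ (-r) := by
    intro i
    rw [abs_mul, abs_of_pos hsθ]
    calc √θ * |ξ i| ≤ √θ * (c * (n : ℝ) ^ (-r)) := by gcongr; exact (h1 i).le
      _ = m / 2 * (n : ℝ) ^ (-r) := by rw [hc]; field_simp
  have hyρ : ∀ i, |y i| ≤ ρ n := fun i =>
    (abs_add_le _ _).trans (add_le_add le_rfl (hξb i))
  have hρη : ρ n ≤ m * (n : ℝ) ^ (-r) := by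
    simp only [hρ]; linarith
  have hρ0 : 0 ≤ ρ n := by simp only [hρ]; positivity
  obtain ⟨e1, e2⟩ := sums_of_small_continuous_part (x := x) (y := y) (d := gridIncrement j n)
    (fun i => rfl) hρ0 hα hyρ hρη hηα hd
  rw [hdq] at e1 e2
  -- the sum of squares of the continuous part
  have hnb : n * b n = β * T := by simp only [hb]; field_simp
  have e3 : ∑ i, y i ^ 2 - θ * T
      = (β * T * b n + 2 * b n * ∑ i, √θ * ξ i) + θ * (∑ i, ξ i ^ 2 - T) := by
    have : ∀ i, y i ^ 2 = b n * b n + 2 * b n * (√θ * ξ i) + θ * ξ i ^ 2 := by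
      intro i
      have := Real.sq_sqrt hθ.le
      simp only [hy]
      linear_combination (ξ i ^ 2) * this
    rw [Finset.sum_congr rfl fun i _ => this i, Finset.sum_add_distrib, Finset.sum_add_distrib,
      ← Finset.mul_sum Finset.univ (fun i => √θ * ξ i), ← Finset.mul_sum Finset.univ (ξ · ^ 2),
      Finset.sum_const, Finset.card_univ, Fintype.card_fin, nsmul_eq_mul]
    linear_combination (b n) * hnb
  have e4 : |∑ i, √θ * ξ i| ≤ n * ρ n := by
    refine (Finset.abs_sum_le_sum_abs _ _).trans ?_
    refine (Finset.sum_le_card_nsmul _ _ (ρ n) fun i _ => (hξb i).trans ?_).trans (le_of_eq ?_)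
    · simp only [hρ]; linarith [abs_nonneg (b n)]
    · rw [Finset.card_univ, Fintype.card_fin, nsmul_eq_mul]
  have e5 : |∑ i, y i ^ 2 - θ * T| < |β| * T * |b n| + 2 * (|β| * T) * ρ n + T * δ / 2 := by
    have hnb' : n * |b n| = |β| * T := by
      rw [← abs_of_pos hn', ← abs_mul, hnb, abs_mul, abs_of_pos hT']
    rw [e3]
    refine (abs_add_le _ _).trans_lt (add_lt_add_of_le_of_lt ((abs_add_le _ _).trans
      (add_le_add ?_ ?_)) ?_)
    · rw [abs_mul, abs_mul, abs_of_pos hT']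
    · rw [abs_mul, abs_mul, abs_two, ← hnb']
      calc 2 * |b n| * |∑ i, √θ * ξ i| ≤ 2 * |b n| * (n * ρ n) := by gcongr
        _ = _ := by ring
    · rw [abs_mul, abs_of_pos hθ]
      calc θ * |∑ i, ξ i ^ 2 - T| < θ * (T * δ / (2 * θ)) := by gcongr
        _ = _ := by field_simp
  have hq0 : 0 ≤ q := by rw [← hdq]; positivity
  have g1 : 0 ≤ ρ n ^ 2 * q / α ^ 2 := by positivity
  have g2 : 0 ≤ 2 * ρ n * q / α := by positivity
  have scale : ∀ z : ℝ, |T * z| < T * δ → |z| < δ := by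
    intro z hz
    rw [abs_mul, abs_of_pos hT'] at hz
    exact lt_of_mul_lt_mul_left hz hT'.le
  simp only [hG] at hGn
  constructor
  · refine scale _ ?_
    have : T * (mle T x - (θ + (T : ℝ)⁻¹ * q))
        = (∑ i, x i ^ 2 - ∑ i, y i ^ 2 - q) + (∑ i, y i ^ 2 - θ * T) := by
      rw [mle]; field_simp; ring
    rw [this]
    refine (abs_add_le _ _).trans_lt ?_
    linarith
  · refine scale _ ?_
    have : T * (mle T x - (T : ℝ)⁻¹ * jumpQV (m * (n : ℝ) ^ (-r)) x - θ)
        = (∑ i, x i ^ 2 - jumpQV (m * (n : ℝ) ^ (-r)) x - ∑ i, y i ^ 2)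
          + (∑ i, y i ^ 2 - θ * T) := by
      rw [mle]; field_simp; ring
    rw [this]
    refine (abs_add_le _ _).trans_lt ?_
    linarith

/-! ### Convergence in probability -/

/-- The samples for which `mle` is not `δ`-close to `t` or the estimator `mle - T⁻¹ jumpQV` of the
diffusion coefficient is not `δ`-close to `θ`. -/
def farSet (T θ η t δ : ℝ) (n : ℕ) : Set (Fin n → ℝ) :=
  {x | ¬ (|mle T x - t| < δ ∧ |mle T x - T⁻¹ * jumpQV η x - θ| < δ)}

lemma measurableSet_farSet (T θ η t δ : ℝ) (n : ℕ) : MeasurableSet (farSet T θ η t δ n) := by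
  have h1 := measurable_mle T n
  have h2 := measurable_jumpQV η n
  have h3 : Measurable fun x : Fin n → ℝ => |mle T x - t| := by fun_prop
  have h4 : Measurable fun x : Fin n → ℝ => |mle T x - T⁻¹ * jumpQV η x - θ| := by fun_prop
  exact ((measurableSet_lt h3 measurable_const).inter (measurableSet_lt h4 measurable_const)).compl

section

variable {Ω : Type*} [MeasurableSpace Ω] {P : Measure Ω} [IsProbabilityMeasure P]
  {T : ℝ≥0} {β θ : ℝ} {W J : Horizon T → Ω → ℝ}

/-- The estimators are consistent for the conditional distribution of the sample given almost every
path of the jump process. -/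
theorem ae_tendsto_condDistrib_farSet (hT : 0 < T) (hθ : 0 < θ) (hWm : ∀ t, Measurable (W t))
    (hJm : ∀ t, Measurable (J t)) (hW : IsBrownianOn T W P)
    (hJ : ∀ᵐ ω ∂P, IsFinitePureJump (path J ω)) (hWJ : IndepFun (path W) (path J) P)
    {m r : ℝ} (hm : 0 < m) (hr0 : 0 < r) (hr1 : r < 1 / 2) :
    ∀ᵐ ω ∂P, ∀ δ > 0, Tendsto (fun n : ℕ =>
      condDistrib (increments β θ W J n) (path J) P (path J ω)
        (farSet T θ (m * (n : ℝ) ^ (-r)) (θ + (T : ℝ)⁻¹ * quadVar (path J ω)) δ n))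
      atTop (𝓝 0) := by
  have hcd : ∀ᵐ ω ∂P, ∀ n, condDistrib (increments β θ W J n) (path J) P (path J ω)
      = P.map fun ω' => pathIncrements β θ n (path W ω') (path J ω) := by
    refine ae_all_iff.mpr fun n => ?_
    have := condDistrib_comp_ae_eq_of_indepFun (measurable_path hWm) (measurable_path hJm) hWJ
      (measurable_pathIncrements β θ n)
    rw [increments_eq]
    exact ae_of_ae_map (measurable_path hJm).aemeasurable this
  filter_upwards [hcd, hJ] with ω hω hj δ hδ
  refine (hW.tendsto_measure_estimators hT β hθ hm hr0 hr1 hj hδ).congr fun n => ?_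
  have hmeas : Measurable fun ω' => pathIncrements β θ n (path W ω') (path J ω) :=
    (measurable_pathIncrements β θ n).comp ((measurable_path hWm).prodMk measurable_const)
  rw [hω n, Measure.map_apply hmeas (measurableSet_farSet _ _ _ _ _ _)]
  rfl

lemma map_apply_eq_lintegral_condDistrib (hWm : ∀ t, Measurable (W t))
    (hJm : ∀ t, Measurable (J t)) (n : ℕ) {A : Set (Fin n → ℝ)} (hA : MeasurableSet A) :
    P.map (increments β θ W J n) A
      = ∫⁻ ω, condDistrib (increments β θ W J n) (path J) P (path J ω) A ∂P := by
  have hD : Measurable (increments β θ W J n) := by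
    rw [increments_eq]
    exact (measurable_pathIncrements β θ n).comp ((measurable_path hWm).prodMk (measurable_path hJm))
  rw [← condDistrib_comp_map (μ := P) (measurable_path hJm).aemeasurable hD.aemeasurable,
    Measure.bind_apply hA (Kernel.aemeasurable _),
    lintegral_map (Kernel.measurable_coe _ hA) (measurable_path hJm)]

/-- The limits `t` of `mle` at which the discrepancy is at most `ε` for `n ≥ k` and estimators in
a neighbourhood of size `1 / (k + 1)`. -/
def uniformSet (T : ℝ) (π : ℝ → ℝ) (θ m r ε : ℝ) (k : ℕ) : Set ℝ :=
  {t | ∀ n ≥ k, ∀ x : Fin n → ℝ, x ∉ farSet T θ (m * (n : ℝ) ^ (-r)) t (1 / (k + 1)) n →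
    normalDiscrepancy T π θ (m * (n : ℝ) ^ (-r)) x ≤ ε}

/-- The samples for which `mle` is not close to `uniformSet` or `mle - T⁻¹ jumpQV` is not close
to `θ`. It is a measurable set, defined by an open neighbourhood of `uniformSet`, that contains all
samples with discrepancy larger than `ε`; the discrepancy itself is not known to be measurable. -/
def exceptionalSet (T : ℝ) (π : ℝ → ℝ) (θ m r ε : ℝ) (k n : ℕ) : Set (Fin n → ℝ) :=
  {x | ¬ (mle T x ∈ Metric.thickening (1 / (k + 1) / 2) (uniformSet T π θ m r ε k) ∧
    |mle T x - T⁻¹ * jumpQV (m * (n : ℝ) ^ (-r)) x - θ| < 1 / (k + 1))}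

lemma measurableSet_exceptionalSet (T : ℝ) (π : ℝ → ℝ) (θ m r ε : ℝ) (k n : ℕ) :
    MeasurableSet (exceptionalSet T π θ m r ε k n) := by
  have h1 := measurable_mle T n
  have h2 := measurable_jumpQV (m * (n : ℝ) ^ (-r)) n
  have h3 : Measurable fun x : Fin n → ℝ =>
      |mle T x - T⁻¹ * jumpQV (m * (n : ℝ) ^ (-r)) x - θ| := by fun_prop
  exact ((h1 Metric.isOpen_thickening.measurableSet).inter
    (measurableSet_lt h3 measurable_const)).compl

lemma subset_exceptionalSet (T : ℝ) (π : ℝ → ℝ) (θ m r ε : ℝ) {k n : ℕ} (hn : k ≤ n) :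
    {x : Fin n → ℝ | ε < normalDiscrepancy T π θ (m * (n : ℝ) ^ (-r)) x}
      ⊆ exceptionalSet T π θ m r ε k n := by
  rintro x hx ⟨h1, h2⟩
  have hx' : ε < normalDiscrepancy T π θ (m * (n : ℝ) ^ (-r)) x := hx
  obtain ⟨t, ht, hd⟩ := Metric.mem_thickening_iff.mp h1
  refine hx'.not_ge (ht n hn x (not_not.mpr ⟨?_, h2⟩))
  rw [Real.dist_eq] at hd
  exact hd.trans (half_lt_self (by positivity))

lemma exceptionalSet_subset_farSet (T : ℝ) (π : ℝ → ℝ) (θ m r ε : ℝ) {k n : ℕ} {t : ℝ}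
    (ht : t ∈ uniformSet T π θ m r ε k) :
    exceptionalSet T π θ m r ε k n ⊆ farSet T θ (m * (n : ℝ) ^ (-r)) t (1 / (k + 1) / 2) n := by
  rintro x hx ⟨h1, h2⟩
  refine hx ⟨Metric.mem_thickening_iff.mpr ⟨t, ht, h1⟩, h2.trans (half_lt_self ?_)⟩
  positivity

lemma eventually_mem_uniformSet {T : ℝ} (hT : 0 < T) {π : ℝ → ℝ} (hπ : IsPriorDensity π) {θ : ℝ}
    (hθ : 0 < θ) (m r : ℝ) {ε : ℝ} (hε : 0 < ε) {t : ℝ} (ht : 0 < t)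
    (hcp : ContinuousPositiveNear π t) : ∀ᶠ k in atTop, t ∈ uniformSet T π θ m r ε k := by
  obtain ⟨δ, hδ, N, h⟩ := exists_forall_normalDiscrepancy_le hT hπ hθ ht hcp hε
  filter_upwards [eventually_ge_atTop N,
    (tendsto_one_div_add_atTop_nhds_zero_nat (𝕜 := ℝ)).eventually_lt_const hδ] with k hk hkδ n hn x hx
  obtain ⟨h1, h2⟩ := not_not.mp hx
  exact h n (hk.trans hn) _ x (h1.trans hkδ) (h2.trans hkδ)

/-- If the exceptional sets have small conditional probability, then their unconditional
probability is small by Fatou's lemma. -/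
theorem tendsToZeroInProb_map (hT : 0 < T) (hθ : 0 < θ) (hWm : ∀ t, Measurable (W t))
    (hJm : ∀ t, Measurable (J t)) {π : ℝ → ℝ} (hπ : IsPriorDensity π) {m r : ℝ}
    (hcons : ∀ᵐ ω ∂P, ∀ δ > 0, Tendsto (fun n : ℕ =>
      condDistrib (increments β θ W J n) (path J) P (path J ω)
        (farSet T θ (m * (n : ℝ) ^ (-r)) (θ + (T : ℝ)⁻¹ * quadVar (path J ω)) δ n))
      atTop (𝓝 0))
    (hcp : ∀ᵐ ω ∂P, ContinuousPositiveNear π (θ + (T : ℝ)⁻¹ * quadVar (path J ω))) :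
    TendsToZeroInProb (fun n => P.map (increments β θ W J n))
      (fun n x => normalDiscrepancy T π θ (m * (n : ℝ) ^ (-r)) x) := by
  intro ε hε
  have hT' : (0 : ℝ) < T := by exact_mod_cast hT
  let f : ℕ → ℕ → Ω → ℝ≥0∞ := fun k n ω =>
    condDistrib (increments β θ W J n) (path J) P (path J ω) (exceptionalSet T π θ m r ε k n)
  have hfm : ∀ k n, Measurable (f k n) := fun k n =>
    (Kernel.measurable_coe _ (measurableSet_exceptionalSet T π θ m r ε k n)).comp
      (measurable_path hJm)
  have hf1 : ∀ k n ω, f k n ω ≤ 1 := fun k n ω => prob_le_one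
  let g : ℕ → Ω → ℝ≥0∞ := fun k ω => limsup (fun n => f k n ω) atTop
  have hg : Tendsto (fun k => ∫⁻ ω, g k ω ∂P) atTop (𝓝 0) := by
    have := tendsto_lintegral_of_dominated_convergence (μ := P) (F := g) (f := fun _ => 0)
      (fun _ => 1) (fun k => Measurable.limsup (hfm k))
      (fun k => ae_of_all _ fun ω => limsup_le_of_le (by isBoundedDefault)
        (Eventually.of_forall fun n => hf1 k n ω)) (by simp) ?_
    · simpa using this
    · filter_upwards [hcons, hcp] with ω h1 h2
      refine tendsto_const_nhds.congr' ?_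
      have hpos : 0 < θ + (T : ℝ)⁻¹ * quadVar (path J ω) := by
        have := quadVar_nonneg (path J ω); positivity
      filter_upwards [eventually_mem_uniformSet hT' hπ hθ m r hε hpos h2] with k hk
      refine (Tendsto.limsup_eq ?_).symm
      refine tendsto_of_tendsto_of_tendsto_of_le_of_le tendsto_const_nhds
        (h1 (1 / ((k : ℝ) + 1) / 2) (by positivity)) (fun _ => zero_le) fun n => ?_
      exact measure_mono (exceptionalSet_subset_farSet T π θ m r ε hk)
  have hle : ∀ k, limsup (fun n => P.map (increments β θ W J n)
      {x | ε < normalDiscrepancy T π θ (m * (n : ℝ) ^ (-r)) x}) atTop ≤ ∫⁻ ω, g k ω ∂P := by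
    intro k
    refine le_trans ?_ (limsup_lintegral_le (μ := P) (fun _ => 1) (hfm k)
      (fun n => ae_of_all _ fun ω => hf1 k n ω) (by simp))
    refine limsup_le_limsup ?_
    filter_upwards [eventually_ge_atTop k] with n hn
    rw [← map_apply_eq_lintegral_condDistrib hWm hJm n
      (measurableSet_exceptionalSet T π θ m r ε k n)]
    exact measure_mono (subset_exceptionalSet T π θ m r ε hn)
  refine tendsto_of_le_liminf_of_limsup_le zero_le (ge_of_tendsto' hg hle)

end

end JumpDiffusion

open JumpDiffusion
theorem theorem2 {Ω : Type*} [MeasurableSpace Ω] (P : Measure Ω) [IsProbabilityMeasure P]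
    (T : ℝ≥0) (hT : 0 < T) (β θ : ℝ) (hθ : 0 < θ)
    (W J : Horizon T → Ω → ℝ)
    (hWm : ∀ t, Measurable (W t)) (hJm : ∀ t, Measurable (J t))
    (hW : IsBrownianOn T W P)
    (hJ : ∀ᵐ ω ∂P, IsFinitePureJump (path J ω))
    (hWJ : IndepFun (path W) (path J) P)
    (π : ℝ → ℝ) (hπ : IsPriorDensity π)
    (m r : ℝ) (hm : 0 < m) (hr0 : 0 < r) (hr1 : r < 1 / 2) :
    (∀ᵐ ω ∂P, ContinuousPositiveNear π (θ + (T : ℝ)⁻¹ * quadVar (path J ω)) →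
      TendsToZeroInProb
        (fun n => condDistrib (increments β θ W J n) (path J) P (path J ω))
        (fun n x => normalDiscrepancy T π θ (m * (n : ℝ) ^ (-r)) x)) ∧
    ((∀ᵐ ω ∂P, ContinuousPositiveNear π (θ + (T : ℝ)⁻¹ * quadVar (path J ω))) →
      TendsToZeroInProb
        (fun n => P.map (increments β θ W J n))
        (fun n x => normalDiscrepancy T π θ (m * (n : ℝ) ^ (-r)) x)) := by

  have hT' : (0 : ℝ) < T := by exact_mod_cast hT
  have hcons := ae_tendsto_condDistrib_farSet (β := β) hT hθ hWm hJm hW hJ hWJ hm hr0 hr1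
  refine ⟨?_, tendsToZeroInProb_map hT hθ hWm hJm hπ hcons⟩
  filter_upwards [hcons] with ω hω hcp ε hε
  have hpos : 0 < θ + (T : ℝ)⁻¹ * quadVar (path J ω) := by
    have := quadVar_nonneg (path J ω); positivity
  obtain ⟨δ, hδ, N, h⟩ := exists_forall_normalDiscrepancy_le hT' hπ hθ hpos hcp hε
  refine tendsto_of_tendsto_of_tendsto_of_le_of_le' tendsto_const_nhds (hω δ hδ)
    (Eventually.of_forall fun _ => zero_le) ?_
  filter_upwards [eventually_ge_atTop N] with n hn
  refine measure_mono fun x hx hx' => ?_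
  have hx2 : ε < normalDiscrepancy T π θ (m * (n : ℝ) ^ (-r)) x := hx
  exact hx2.not_ge (h n hn _ x hx'.1 hx'.2)
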